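/- A program computes a real number $a$ if, given any integer $n\ge 1$, it halts and outputs an integer $T(n)$ with $\frac{T(n)-1}{n}\le a\le\frac{T(n)+1}{n}$. A computable pentagon is given by ten programs, which compute the five edge lengths and the five interior angles (in radians), in cyclic order, of a pentagon; the input is promised to describe a simple closed polygon in the Euclidean plane (all edge lengths are positive, the angles lie in $(0,2\pi)$ and sum to $3\pi$, an angle equal to $\pi$ is allowed, the boundary closes up and does not meet itself). The pentagon tiles the plane if the plane is a union of isometric copies of the closed region it bounds, any two distinct copies having disjoint interiors; one may either allow or forbid reflected copies. **Theorem.** Given a single computable pentagon, determining whether it tiles the plane is co-RE-hard and thus undecidable, both when reflected copies are allowed and when they are forbidden. That is, for every set $S\subseteq\mathbb N$ whose complement is recursively enumerable there is a total computable function that maps each $m\in\mathbb N$ to ten programs which satisfy the promise, such that $m\in S$ if and only if the pentagon they describe tiles the plane. Moreover, no algorithm halts with the correct answer on every input that satisfies the promise (whatever it does on other inputs). -/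

import Mathlib

noncomputable section

namespace PentagonTiling

/-! ### Promise problems, hardness for co-RE, undecidability -/

/-- A decision problem on instances of type `α` whose instances come with a promise.  The answer
`yes` only matters for instances that satisfy the promise. -/
structure PromiseProblem (α : Type) where
  promise : α → Prop
  yes : α → Prop

/-- Every co-RE set of natural numbers many-one reduces, by a total computable function, to the
problem; the reduction only produces instances that satisfy the promise. -/
def PromiseProblem.CoREHard {α : Type} [Primcodable α] (Q : PromiseProblem α) : Prop :=
  ∀ p : ℕ → Prop, REPred (fun n => ¬ p n) →
    ∃ f : ℕ → α, Computable f ∧ ∀ n, Q.promise (f n) ∧ (p n ↔ Q.yes (f n))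

/-- An algorithm decides the problem if it halts with the right answer on every instance that
satisfies the promise; on other instances it may do anything, including running forever. -/
def PromiseProblem.Decidable {α : Type} [Primcodable α] (Q : PromiseProblem α) : Prop :=
  ∃ g : α →. Bool, Partrec g ∧
    ∀ a, Q.promise a → (Q.yes a → true ∈ g a) ∧ (¬ Q.yes a → false ∈ g a)

/-! ### Computable real numbers -/

/-- The program `c` computes the real number `a`: on every input `n ≥ 1` it halts and outputs (the
code of) an integer `z` with `(z - 1) / n ≤ a ≤ (z + 1) / n`. -/
def ComputesReal (c : Nat.Partrec.Code) (a : ℝ) : Prop :=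
  ∀ n : ℕ, 1 ≤ n → ∃ z : ℤ, Encodable.encode z ∈ c.eval n ∧
    ((z : ℝ) - 1) / n ≤ a ∧ a ≤ ((z : ℝ) + 1) / n

/-! ### Polygons given by edge lengths and angles

The plane is `ℂ`.  A polygon with `n` vertices is given by edge lengths `L` and interior angles `θ`
(in radians).  It is drawn counterclockwise from the origin, starting in the direction of the
positive real axis: `L i` is the length of the edge from the `i`-th to the `(i+1)`-st vertex, and
`θ i` is the angle at the `i`-th vertex. -/

/-- Direction (argument) of the `i`-th edge: one turns left by `π - θ j` at the `j`-th vertex. -/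
def heading {n : ℕ} (θ : Fin n → ℝ) (i : Fin n) : ℝ :=
  ∑ j : Fin n with 0 < j.val ∧ j ≤ i, (Real.pi - θ j)

/-- The `k`-th vertex, `0 ≤ k ≤ n`; if the polygon closes up, the `n`-th is the `0`-th. -/
def vertex {n : ℕ} (L θ : Fin n → ℝ) (k : ℕ) : ℂ :=
  ∑ j : Fin n with j.val < k, (L j : ℂ) * Complex.exp (heading θ j * Complex.I)

/-- The `i`-th edge with its initial point but without its final point. -/
def halfOpenEdge {n : ℕ} (L θ : Fin n → ℝ) (i : Fin n) : Set ℂ :=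
  AffineMap.lineMap (k := ℝ) (vertex L θ i.val) (vertex L θ (i.val + 1)) '' Set.Ico 0 1

/-- The data `L`, `θ` describe a simple closed polygon with interior angles `θ`.  Angles equal to
`π` are allowed.  The angle sum says that the boundary closes up with the right angle at the initial
vertex and that the angles are those on the inner side. -/
structure IsSimpleClosedPolygon {n : ℕ} (L θ : Fin n → ℝ) : Prop where
  three_le : 3 ≤ n
  length_pos : ∀ i, 0 < L i
  angle_pos : ∀ i, 0 < θ i
  angle_lt : ∀ i, θ i < 2 * Real.pi
  angle_sum : ∑ i, θ i = ((n : ℝ) - 2) * Real.pi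
  closed : vertex L θ n = vertex L θ 0
  simple : Pairwise fun i j => Disjoint (halfOpenEdge L θ i) (halfOpenEdge L θ j)

/-- The boundary of the polygon. -/
def boundary {n : ℕ} (L θ : Fin n → ℝ) : Set ℂ :=
  ⋃ i : Fin n, segment ℝ (vertex L θ i.val) (vertex L θ (i.val + 1))

/-- The closed region bounded by the polygon: the boundary together with the bounded components
of its complement. -/
def region {n : ℕ} (L θ : Fin n → ℝ) : Set ℂ :=
  boundary L θ ∪
    {x | x ∉ boundary L θ ∧ Bornology.IsBounded (connectedComponentIn (boundary L θ)ᶜ x)}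

/-! ### Tilings of the plane -/

/-- The isometries of the plane that preserve orientation: rotations and translations. -/
def properMotions : Set (ℂ ≃ᵢ ℂ) :=
  {g | ∃ a b : ℂ, ‖a‖ = 1 ∧ ∀ z, g z = a * z + b}

/-- The prototile `P` tiles the plane, with tiles placed by isometries from `G`: some collection of
such copies of `P` covers the plane, and distinct tiles have disjoint interiors. -/
def TilesPlane (G : Set (ℂ ≃ᵢ ℂ)) (P : Set ℂ) : Prop :=
  ∃ 𝒯 : Set (Set ℂ), (∀ T ∈ 𝒯, ∃ g ∈ G, T = g '' P) ∧ ⋃₀ 𝒯 = Set.univ ∧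
    𝒯.Pairwise fun S T => Disjoint (interior S) (interior T)

/-! ### The tiling problem for a computable polygon -/

/-- Input of the problem: a program for each edge length and a program for each angle. -/
abbrev PolygonCode (n : ℕ) : Type :=
  (Fin n → Nat.Partrec.Code) × (Fin n → Nat.Partrec.Code)

/-- The programs in `d` compute the edge lengths `L` and the angles `θ`. -/
def PolygonCode.Computes {n : ℕ} (d : PolygonCode n) (L θ : Fin n → ℝ) : Prop :=
  (∀ i, ComputesReal (d.1 i) (L i)) ∧ ∀ i, ComputesReal (d.2 i) (θ i)

/-- Given a computable polygon with `n` vertices (promised to be simple and closed), does it tile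
the plane by isometric copies taken from `G`? -/
def tilingProblem (n : ℕ) (G : Set (ℂ ≃ᵢ ℂ)) : PromiseProblem (PolygonCode n) where
  promise d := ∃ L θ : Fin n → ℝ, d.Computes L θ ∧ IsSimpleClosedPolygon L θ
  yes d := ∃ L θ : Fin n → ℝ, d.Computes L θ ∧ IsSimpleClosedPolygon L θ ∧
    TilesPlane G (region L θ)

end PentagonTiling

end

/-! ### Angles measured by area -/

section

open MeasureTheory Set Filter Topology
open scoped ComplexConjugate ENNReal Real

namespace PentagonTiling

/-! ### The area of a sector -/

/-! Take a 2 × 1 rectangle and regard the midpoint of one long side as a fifth vertex, with angle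
`π`. Bend that side outwards, so that this angle becomes `π - 4φ` and the other four become `π / 2 +
φ`. For `φ = 0` the rectangle tiles by translations (`tilesPlane_rectangle`). For `0 < φ ≤ 1/5`
there is no tiling: around the bent vertex of a tile the angles must sum to `2π`, and every other
tile there contributes `2π`, `π`, `π / 2 + φ` or `π - 4φ`. No such choice makes up the missing `π +
4φ` (`sum_house_angles_ne`, `not_tilesPlane_house`).

The angle sum is obtained from area: near each of its points a convex pentagon agrees with a full
plane, a half-plane or a sector (`IsConvexPentagon.exists_hasAngle`), and the areas that the tiles
cut from a small disc add up to that of the disc (`sum_angles_eq_two_pi`). Tilings need not be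
edge-to-edge.

The bend encodes a computation: `φ = 2 arctan u`, where `u = 0` if a semi-decision procedure for the
complement of the given set never halts, and `u = 1 / (k + 10)` if its search first succeeds at
bound `k`. Running the search up to bound `N` determines `u` to within `1 / N`, so lengths and
angles are computable without knowing whether it halts (`exists_halting_delay`,
`exists_house_reduction`). Undecidability follows from hardness applied to the non-halting programs.
-/

theorem lintegral_indicator_Ioo_ofReal {r : ℝ} (hr : 0 ≤ r) :
    ∫⁻ ρ : ℝ, (Ioo 0 r).indicator ENNReal.ofReal ρ = ENNReal.ofReal (r ^ 2 / 2) := by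
  rw [lintegral_indicator measurableSet_Ioo, Measure.restrict_congr_set Ioo_ae_eq_Ioc,
    ← ofReal_integral_eq_lintegral_ofReal]
  · rw [← intervalIntegral.integral_of_le hr, integral_id]
    simp
  · exact (continuous_id.integrableOn_Icc (a := 0) (b := r)).mono_set Ioc_subset_Icc_self
  · filter_upwards [ae_restrict_mem measurableSet_Ioc] with x hx using hx.1.le

theorem volume_inter_Icc_Iio_pi {θ : ℝ} (hπ : θ ≤ π) :
    volume (Icc 0 θ ∩ Iio π) = ENNReal.ofReal θ := by
  apply le_antisymm
  · exact (measure_mono inter_subset_left).trans (by simp)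
  · have h : Ico 0 θ ⊆ Icc 0 θ ∩ Iio π := fun x hx => ⟨⟨hx.1, hx.2.le⟩, hx.2.trans_le hπ⟩
    simpa using measure_mono (μ := volume) h

theorem sin_sub_nonpos_iff {θ ψ : ℝ} (h0 : 0 ≤ θ) (hπ : θ ≤ π) (h1 : -π < ψ) (h2 : ψ < π) :
    (0 ≤ Real.sin ψ ∧ Real.sin (ψ - θ) ≤ 0) ↔ ψ ∈ Icc 0 θ := by
  constructor
  · rintro ⟨h, h'⟩
    have hψ : 0 ≤ ψ := by
      by_contra! hlt
      exact absurd h (not_le.2 (Real.sin_neg_of_neg_of_neg_pi_lt hlt h1))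
    refine ⟨hψ, ?_⟩
    by_contra! hlt
    exact absurd h' (not_le.2 (Real.sin_pos_of_pos_of_lt_pi (by linarith) (by linarith)))
  · rintro ⟨h, h'⟩
    exact ⟨Real.sin_nonneg_of_nonneg_of_le_pi h h2.le,
      Real.sin_nonpos_of_nonpos_of_neg_pi_le (by linarith) (by linarith)⟩

/-- In polar coordinates the integrand is a function of the radius times a function of the angle, so
the integral is a product. -/
theorem volume_sector {θ : ℝ} (h0 : 0 ≤ θ) (hπ : θ ≤ π) {r : ℝ} (hr : 0 ≤ r) :
    volume ({z : ℂ | 0 ≤ z.im ∧ (z * conj (Complex.exp (θ * Complex.I))).im ≤ 0} ∩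
      Metric.ball 0 r) = ENNReal.ofReal (θ / 2 * r ^ 2) := by
  set S : Set ℂ := {z : ℂ | 0 ≤ z.im ∧ (z * conj (Complex.exp (θ * Complex.I))).im ≤ 0} ∩
      Metric.ball 0 r with hS
  have hSm : MeasurableSet S := by
    refine MeasurableSet.inter (IsClosed.measurableSet ?_) Metric.isOpen_ball.measurableSet
    exact (isClosed_le (by fun_prop : Continuous fun _ : ℂ => (0 : ℝ))
      (by fun_prop : Continuous fun z : ℂ => z.im)).inter
      (isClosed_le (by fun_prop : Continuous fun z : ℂ =>
        (z * conj (Complex.exp (θ * Complex.I))).im) (by fun_prop : Continuous fun _ : ℂ => (0 : ℝ)))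
  rw [← lintegral_indicator_one hSm, ← Complex.lintegral_comp_polarCoord_symm,
    ← lintegral_indicator polarCoord.open_target.measurableSet]
  -- The chart has angles in `(-π, π)`. Intersecting with `Iio π` removes the missing ray when `θ =
  -- π`, so that both sides vanish off the target.
  have key : ∀ p : ℝ × ℝ, polarCoord.target.indicator (fun p : ℝ × ℝ =>
      ENNReal.ofReal p.1 • S.indicator (1 : ℂ → ℝ≥0∞) (Complex.polarCoord.symm p)) p =
      (Ioo 0 r).indicator ENNReal.ofReal p.1 * (Icc 0 θ ∩ Iio π).indicator 1 p.2 := by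
    rintro ⟨ρ, ψ⟩
    by_cases ht : (ρ, ψ) ∈ polarCoord.target
    · rw [indicator_of_mem ht]
      rw [polarCoord_target, mem_prod, mem_Ioi, mem_Ioo] at ht
      obtain ⟨hρ, hψ1, hψ2⟩ := ht
      simp only at hρ hψ1 hψ2
      have hmem : Complex.polarCoord.symm (ρ, ψ) ∈ S ↔ ρ ∈ Ioo 0 r ∧ ψ ∈ Icc 0 θ ∩ Iio π := by
        have hnorm : ‖Complex.polarCoord.symm (ρ, ψ)‖ = ρ := by
          rw [Complex.norm_polarCoord_symm]; exact abs_of_pos hρ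
        have him : (Complex.polarCoord.symm (ρ, ψ)).im = ρ * Real.sin ψ := by
          simp [Complex.polarCoord_symm_apply, Complex.sin_ofReal_re, Complex.cos_ofReal_im]
        have hcr : (Complex.polarCoord.symm (ρ, ψ) *
            conj (Complex.exp (θ * Complex.I))).im = ρ * Real.sin (ψ - θ) := by
          simp [Complex.polarCoord_symm_apply, Complex.exp_ofReal_mul_I_re,
            Complex.exp_ofReal_mul_I_im, Complex.mul_im, Complex.cos_ofReal_re,
            Complex.sin_ofReal_re, Real.sin_sub]
          ring
        have hs : (0 ≤ ρ * Real.sin ψ ∧ ρ * Real.sin (ψ - θ) ≤ 0) ↔ ψ ∈ Icc 0 θ := by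
          rw [mul_nonneg_iff_of_pos_left hρ, mul_nonpos_iff_pos_imp_nonpos,
            ← sin_sub_nonpos_iff h0 hπ hψ1 hψ2]
          constructor
          · rintro ⟨a, b, -⟩; exact ⟨a, b hρ⟩
          · rintro ⟨a, b⟩; exact ⟨a, fun _ => b, fun _ => hρ.le⟩
        rw [hS, mem_inter_iff, mem_ofPred_eq, mem_ball_zero_iff, hnorm, him, hcr, hs]
        simp only [mem_Ioo, mem_inter_iff, mem_Iio, hρ, hψ2, true_and, and_true]
        exact and_comm
      by_cases h : Complex.polarCoord.symm (ρ, ψ) ∈ S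
      · rw [indicator_of_mem h, indicator_of_mem (hmem.1 h).1, indicator_of_mem (hmem.1 h).2]
        simp
      · rw [indicator_of_notMem h]
        rcases not_and_or.1 (mt hmem.2 h) with h | h <;> simp [indicator_of_notMem h]
    · rw [indicator_of_notMem ht]
      rw [polarCoord_target, mem_prod, mem_Ioi, mem_Ioo] at ht
      simp only at ht
      by_cases hρ : ρ ∈ Ioo 0 r
      · have : ψ ∉ Icc 0 θ ∩ Iio π := fun hψ =>
          ht ⟨hρ.1, by linarith [hψ.1.1, Real.pi_pos], hψ.2⟩
        simp [indicator_of_notMem this]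
      · simp [indicator_of_notMem hρ]
  simp_rw [key]
  have hm : MeasurableSet (Icc 0 θ ∩ Iio π) := measurableSet_Icc.inter measurableSet_Iio
  rw [Measure.volume_eq_prod, lintegral_prod_mul
    (ENNReal.measurable_ofReal.indicator measurableSet_Ioo).aemeasurable
    (measurable_one.indicator hm).aemeasurable,
    lintegral_indicator_Ioo_ofReal hr, lintegral_indicator_one hm, volume_inter_Icc_Iio_pi hπ,
    ← ENNReal.ofReal_mul (by positivity)]
  congr 1
  ring

/-! ### The angle of a set at a point -/

/-- The part of the set `K` near the point `p` has the area of a sector with angle `w`. -/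
def HasAngle (K : Set ℂ) (p : ℂ) (w : ℝ) : Prop :=
  ∀ᶠ r in 𝓝[>] (0 : ℝ), volume (K ∩ Metric.ball p r) = ENNReal.ofReal (w / 2 * r ^ 2)

theorem HasAngle.congr {K K' : Set ℂ} {p : ℂ} {w : ℝ} (h : HasAngle K p w)
    (hK : ∀ᶠ z in 𝓝 p, z ∈ K ↔ z ∈ K') : HasAngle K' p w := by
  obtain ⟨ε, hε, hb⟩ := Metric.eventually_nhds_iff_ball.1 hK
  filter_upwards [h, Ioo_mem_nhdsGT hε] with r hr hrε
  rw [← hr]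
  congr 1
  ext z
  simp only [mem_inter_iff, and_congr_left_iff]
  exact fun hz => (hb z (Metric.ball_subset_ball hrε.2.le hz)).symm

/-- Mazur–Ulam: an isometry is a real linear isometry followed by a translation. Areas and convexity
are transported through this form. -/
theorem isometryEquiv_image_eq (g : ℂ ≃ᵢ ℂ) (s : Set ℂ) :
    g '' s = (g 0 + ·) '' (g.toRealLinearIsometryEquiv '' s) := by
  rw [image_image]
  refine image_congr fun z _ => ?_
  simp

theorem volume_isometryEquiv_image (g : ℂ ≃ᵢ ℂ) (s : Set ℂ) : volume (g '' s) = volume s := by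
  rw [isometryEquiv_image_eq, image_add_left, measure_preimage_add, LinearIsometryEquiv.image_eq_preimage_symm]
  exact g.toRealLinearIsometryEquiv.symm.measurePreserving.measure_preimage_emb
    g.toRealLinearIsometryEquiv.symm.toHomeomorph.measurableEmbedding s

theorem HasAngle.image {K : Set ℂ} {p : ℂ} {w : ℝ} (h : HasAngle K p w) (g : ℂ ≃ᵢ ℂ) :
    HasAngle (g '' K) (g p) w := by
  filter_upwards [h] with r hr
  rw [← hr, ← g.image_ball, ← image_inter g.injective]
  exact volume_isometryEquiv_image g _

theorem hasAngle_of_mem_nhds {K : Set ℂ} {p : ℂ} (h : K ∈ 𝓝 p) : HasAngle K p (2 * π) := by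
  refine HasAngle.congr (K := univ) ?_ (by filter_upwards [h] with z hz; simp [hz])
  filter_upwards [self_mem_nhdsWithin] with r hr
  have hr' : 0 ≤ r := le_of_lt hr
  rw [univ_inter, Complex.volume_ball, ← ENNReal.ofReal_pow hr']
  rw [← ENNReal.ofReal_coe_nnreal, ← ENNReal.ofReal_mul (by positivity)]
  congr 1
  simp
  ring

/-- A sector with arbitrary apex and direction. -/
theorem hasAngle_sector {θ : ℝ} (h0 : 0 ≤ θ) (hπ : θ ≤ π) (p : ℂ) {d : ℂ} (hd : ‖d‖ = 1) :
    HasAngle {z : ℂ | 0 ≤ ((z - p) * conj d).im ∧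
      ((z - p) * conj (d * Complex.exp (θ * Complex.I))).im ≤ 0} p θ := by
  have h : HasAngle {z : ℂ | 0 ≤ z.im ∧ (z * conj (Complex.exp (θ * Complex.I))).im ≤ 0} 0 θ := by
    filter_upwards [self_mem_nhdsWithin] with r hr
    exact volume_sector h0 hπ (le_of_lt hr)
  have hd1 : d * conj d = 1 := by rw [Complex.mul_conj, Complex.normSq_eq_norm_sq, hd]; simp
  let g : ℂ ≃ᵢ ℂ := (rotation ⟨d, by simp [Submonoid.unitSphere, hd]⟩).toIsometryEquiv.trans
    (IsometryEquiv.addRight p)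
  have hg : ∀ z, g z = d * z + p := fun z => by simp [g]; rfl
  have := h.image g
  rw [hg, mul_zero, zero_add] at this
  convert this using 1
  ext z
  obtain ⟨y, rfl⟩ := g.surjective z
  rw [g.injective.mem_set_image, hg]
  simp only [mem_ofPred_eq, add_sub_cancel_right, map_mul]
  have e1 : d * y * conj d = y := by linear_combination y * hd1
  have e2 : ∀ a, d * y * (conj d * a) = y * a := fun a => by linear_combination y * a * hd1
  rw [e1, e2]

theorem hasAngle_halfPlane (p : ℂ) {d : ℂ} (hd : ‖d‖ = 1) :
    HasAngle {z : ℂ | 0 ≤ ((z - p) * conj d).im} p π := by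
  convert hasAngle_sector Real.pi_pos.le le_rfl p hd using 1
  ext z
  simp

end PentagonTiling

end

/-! ### Convex regions, and the angle sum at a point of a tiling -/

section

open MeasureTheory Set Filter Topology
open scoped ComplexConjugate ENNReal Real

namespace PentagonTiling

/-! ### The region bounded by a convex polygon -/

/-- Convexity replaces the Jordan curve theorem. The complement of the boundary is the disjoint
union of the open sets `U` and `Kᶜ`. Components meeting `U` stay inside the bounded set `K`, while
from a point outside `K` the ray pointing away from a point of `K` never meets `K`, so its component
is unbounded. -/
theorem region_eq_of_boundary_eq {n : ℕ} {L θ : Fin n → ℝ} {K U : Set ℂ} (hK : Convex ℝ K)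
    (hKc : IsCompact K) (hKn : K.Nonempty) (hU : IsOpen U) (hUK : U ⊆ K)
    (hB : boundary L θ = K \ U) : region L θ = K := by
  have hcompl : (boundary L θ)ᶜ = U ∪ Kᶜ := by
    rw [hB]; ext z; have := @hUK z; simp only [mem_compl_iff, Set.mem_sdiff, mem_union]; tauto
  have hdisj : Disjoint U Kᶜ := disjoint_compl_right.mono_left hUK
  ext z
  simp only [region, mem_union, mem_ofPred_eq]
  by_cases hzU : z ∈ U
  · have hz : z ∈ (boundary L θ)ᶜ := by rw [hcompl]; exact Or.inl hzU
    refine iff_of_true (Or.inr ⟨hz, hKc.isBounded.subset (Subset.trans ?_ hUK)⟩) (hUK hzU)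
    refine isPreconnected_connectedComponentIn.subset_left_of_subset_union hU
      hKc.isClosed.isOpen_compl hdisj ?_ ⟨z, mem_connectedComponentIn hz, hzU⟩
    rw [← hcompl]
    exact connectedComponentIn_subset _ _
  · by_cases hzK : z ∈ K
    · exact iff_of_true (Or.inl (by rw [hB]; exact ⟨hzK, hzU⟩)) hzK
    · refine iff_of_false ?_ hzK
      have hzB : z ∈ (boundary L θ)ᶜ := by rw [hcompl]; exact Or.inr hzK
      rintro (h | ⟨-, hbd⟩)
      · exact hzB h
      obtain ⟨k, hk⟩ := hKn
      have hne : z - k ≠ 0 := sub_ne_zero.2 fun h => hzK (h ▸ hk)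
      let γ : ℝ → ℂ := fun s => z + s • (z - k)
      have hγK : ∀ s ∈ Ici (0 : ℝ), γ s ∉ K := by
        intro s hs hmem
        have hs' : 0 ≤ s := hs
        refine hzK ?_
        have h1 : 0 < 1 + s := by positivity
        -- `z` lies between `γ s` and `k`, with these weights.
        have := hK hmem hk (a := 1 / (1 + s)) (b := s / (1 + s)) (by positivity) (by positivity)
          (by field_simp)
        convert this using 1
        have h1' : (1 + s : ℂ) ≠ 0 := by exact_mod_cast h1.ne'
        simp only [γ, Complex.real_smul]
        push_cast
        field_simp
        ring
      have hγ : γ '' Ici 0 ⊆ connectedComponentIn (boundary L θ)ᶜ z := by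
        refine IsPreconnected.subset_connectedComponentIn ?_ ⟨0, by simp, by simp [γ]⟩ ?_
        · exact isPreconnected_Ici.image _ (by fun_prop)
        · rintro _ ⟨s, hs, rfl⟩
          rw [hcompl]
          exact Or.inr (hγK s hs)
      obtain ⟨C, hC⟩ := (hbd.subset hγ).exists_norm_le
      have hpos : 0 < ‖z - k‖ := norm_pos_iff.2 hne
      set s : ℝ := (|C| + ‖z‖ + 1) / ‖z - k‖ with hs
      have hs0 : 0 ≤ s := by positivity
      have h1 := hC _ ⟨s, hs0, rfl⟩
      have h2 : ‖s • (z - k)‖ = |C| + ‖z‖ + 1 := by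
        rw [norm_smul, Real.norm_of_nonneg hs0, hs]; field_simp
      have h3 : ‖s • (z - k)‖ ≤ ‖γ s‖ + ‖z‖ := by
        have := norm_sub_le (γ s) z
        simpa [γ] using this
      linarith [le_abs_self C]

/-! ### The angles at a point of a tiling -/

/-- The interiors of these tiles are disjoint, have the same positive area and lie in one larger
ball. -/
theorem finite_tiles_meeting_ball {P : Set ℂ} (hPc : IsCompact P) (hPi : (interior P).Nonempty)
    {𝒯 : Set (Set ℂ)} (hT : ∀ T ∈ 𝒯, ∃ g : ℂ ≃ᵢ ℂ, T = g '' P)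
    (hd : 𝒯.Pairwise fun S T => Disjoint (interior S) (interior T)) (v : ℂ) (r : ℝ) :
    {T ∈ 𝒯 | (T ∩ Metric.ball v r).Nonempty}.Finite := by
  set 𝒮 : Set (Set ℂ) := {T ∈ 𝒯 | (T ∩ Metric.ball v r).Nonempty}
  have hvol : 0 < volume (interior P) := isOpen_interior.measure_pos _ hPi
  have hint : ∀ g : ℂ ≃ᵢ ℂ, interior (g '' P) = g '' interior P :=
    fun g => (g.toHomeomorph.image_interior P).symm
  have hsub : (⋃ T : 𝒮, interior T.1) ⊆ Metric.ball v (r + (Metric.diam P + 1)) := by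
    refine iUnion_subset fun T => interior_subset.trans ?_
    obtain ⟨T, hT𝒯, x, hxT, hxv⟩ := T
    obtain ⟨g, rfl⟩ := hT T hT𝒯
    intro y hy
    have hb : Bornology.IsBounded (g '' P) := (hPc.image g.continuous).isBounded
    have h1 : dist y x ≤ Metric.diam P := by
      rw [← g.diam_image]; exact Metric.dist_le_diam_of_mem hb hy hxT
    have h2 := dist_triangle y x v
    rw [Metric.mem_ball] at hxv ⊢
    linarith
  have hfin := Measure.finite_const_le_meas_of_disjoint_iUnion volume hvol
    (As := fun T : 𝒮 => interior T.1) (fun T => isOpen_interior.measurableSet)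
    (fun S T hST => hd S.2.1 T.2.1 fun h => hST (Subtype.ext h))
    ((measure_mono hsub).trans_lt measure_ball_lt_top).ne
  have huniv : {T : 𝒮 | volume (interior P) ≤ volume (interior T.1)} = univ := by
    refine eq_univ_of_forall fun T => ?_
    obtain ⟨g, hg⟩ := hT T.1 T.2.1
    rw [mem_ofPred_eq, hg, hint, volume_isometryEquiv_image]
  rw [huniv] at hfin
  have := finite_univ_iff.1 hfin
  exact 𝒮.toFinite

/-- The angles of the tiles around a point of a tiling by convex tiles sum to `2 * π`. -/
theorem sum_angles_eq_two_pi {P : Set ℂ} (hPc : IsCompact P) (hPconv : Convex ℝ P)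
    (hPi : (interior P).Nonempty)
    {𝒯 : Set (Set ℂ)} (hT : ∀ T ∈ 𝒯, ∃ g : ℂ ≃ᵢ ℂ, T = g '' P) (hcov : ⋃₀ 𝒯 = univ)
    (hd : 𝒯.Pairwise fun S T => Disjoint (interior S) (interior T)) (v : ℂ)
    {w : Set ℂ → ℝ} (hw : ∀ T ∈ 𝒯, v ∈ T → HasAngle T v (w T) ∧ 0 ≤ w T) :
    ∃ s : Finset (Set ℂ), (∀ T, T ∈ s ↔ T ∈ 𝒯 ∧ v ∈ T) ∧ ∑ T ∈ s, w T = 2 * π := by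
  classical
  have hfin := finite_tiles_meeting_ball hPc hPi hT hd v 1
  have hcl : ∀ T ∈ 𝒯, IsClosed T := by
    intro T hT𝒯
    obtain ⟨g, rfl⟩ := hT T hT𝒯
    exact (hPc.image g.continuous).isClosed
  have hconv : ∀ T ∈ 𝒯, Convex ℝ T := by
    intro T hT𝒯
    obtain ⟨g, rfl⟩ := hT T hT𝒯
    rw [isometryEquiv_image_eq]
    exact (hPconv.linear_image g.toRealLinearIsometryEquiv.toLinearEquiv.toLinearMap).translate _
  have hsub : {T ∈ 𝒯 | v ∈ T} ⊆ {T ∈ 𝒯 | (T ∩ Metric.ball v 1).Nonempty} :=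
    fun T h => ⟨h.1, v, h.2, Metric.mem_ball_self one_pos⟩
  set s := (hfin.subset hsub).toFinset with hs
  have hmem : ∀ T, T ∈ s ↔ T ∈ 𝒯 ∧ v ∈ T := fun T => by simp [hs]
  refine ⟨s, hmem, ?_⟩
  -- the tiles near `v` that do not contain `v`
  have hfar : ∀ᶠ z in 𝓝 v, ∀ T ∈ {T ∈ 𝒯 | (T ∩ Metric.ball v 1).Nonempty}, v ∉ T → z ∉ T := by
    rw [eventually_all_finite hfin]
    intro T hT𝒯
    by_cases hvT : v ∈ T
    · simp [hvT]
    · filter_upwards [(hcl T hT𝒯.1).isOpen_compl.mem_nhds hvT] with z hz _ using hz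
  obtain ⟨ε, hε, hfar⟩ := Metric.eventually_nhds_iff_ball.1 hfar
  have hang : ∀ᶠ r in 𝓝[>] (0 : ℝ), ∀ T ∈ s,
      volume (T ∩ Metric.ball v r) = ENNReal.ofReal (w T / 2 * r ^ 2) := by
    rw [Filter.eventually_all_finset]
    exact fun T hTs => (hw T ((hmem T).1 hTs).1 ((hmem T).1 hTs).2).1
  -- For such `r` only tiles containing `v` meet the disc, and each has its sector area there.
  obtain ⟨r, hr, ⟨hr0, hrε⟩⟩ := (hang.and (Ioo_mem_nhdsGT (lt_min hε one_pos))).exists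
  have hball : Metric.ball v r = ⋃ T ∈ s, T ∩ Metric.ball v r := by
    ext z
    simp only [mem_iUnion, mem_inter_iff, exists_prop]
    refine ⟨fun hz => ?_, fun ⟨T, _, _, hz⟩ => hz⟩
    obtain ⟨T, hT𝒯, hzT⟩ := (hcov ▸ mem_univ z : z ∈ ⋃₀ 𝒯)
    refine ⟨T, (hmem T).2 ⟨hT𝒯, ?_⟩, hzT, hz⟩
    by_contra hvT
    exact hfar z (Metric.ball_subset_ball (hrε.le.trans (min_le_left _ _)) hz) T
      ⟨hT𝒯, z, hzT, Metric.ball_subset_ball (hrε.le.trans (min_le_right _ _)) hz⟩ hvT hzT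
  -- Common points of two tiles lie on one of the frontiers, and the frontier of a convex set is
  -- null.
  have hae : (↑s : Set (Set ℂ)).Pairwise (Function.onFun (AEDisjoint volume) fun T => T ∩ Metric.ball v r) := by
    intro S hS T hT' hST
    have hS𝒯 := ((hmem S).1 hS).1
    have hT𝒯 := ((hmem T).1 hT').1
    refine measure_mono_null (t := frontier S ∪ frontier T) ?_
      (measure_union_null ((hconv S hS𝒯).addHaar_frontier volume)
        ((hconv T hT𝒯).addHaar_frontier volume))
    rintro z ⟨⟨hzS, -⟩, ⟨hzT, -⟩⟩
    rw [(hcl S hS𝒯).frontier_eq, (hcl T hT𝒯).frontier_eq]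
    by_cases h : z ∈ interior S
    · exact Or.inr ⟨hzT, fun h' => (disjoint_left.1 (hd hS𝒯 hT𝒯 hST)) h h'⟩
    · exact Or.inl ⟨hzS, h⟩
  have hsum : volume (Metric.ball v r) = ∑ T ∈ s, volume (T ∩ Metric.ball v r) := by
    conv_lhs => rw [hball]
    refine measure_biUnion_finset₀ hae fun T hTs => MeasurableSet.nullMeasurableSet ?_
    exact (hcl T ((hmem T).1 hTs).1).measurableSet.inter Metric.isOpen_ball.measurableSet
  have hwnn : ∀ T ∈ s, 0 ≤ w T := fun T hTs => (hw T ((hmem T).1 hTs).1 ((hmem T).1 hTs).2).2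
  rw [Finset.sum_congr rfl hr, ← ENNReal.ofReal_sum_of_nonneg
    (fun T hTs => mul_nonneg (div_nonneg (hwnn T hTs) two_pos.le) (sq_nonneg r)),
    Complex.volume_ball, ← ENNReal.ofReal_pow hr0.le, ← ENNReal.ofReal_coe_nnreal,
    ← ENNReal.ofReal_mul (by positivity), ENNReal.ofReal_eq_ofReal_iff (by positivity)
    (Finset.sum_nonneg fun T hTs => mul_nonneg (div_nonneg (hwnn T hTs) two_pos.le) (sq_nonneg r)),
    ← Finset.sum_mul, ← Finset.sum_div] at hsum
  have hr2 : r ^ 2 ≠ 0 := by positivity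
  rw [mul_comm] at hsum
  have := mul_right_cancel₀ hr2 hsum
  simp only [NNReal.coe_real_pi] at this
  linarith

end PentagonTiling

end

section

open MeasureTheory Set Filter Topology
open scoped ComplexConjugate ENNReal Real

namespace PentagonTiling

/-! ### Strictly convex pentagons -/

/-- The signed distance of `z` from the line through `p` with direction `d`, positive on the left. -/
def side (p d z : ℂ) : ℝ := ((z - p) * conj d).im

theorem side_eq (p d z : ℂ) : side p d z = d.re * (z.im - p.im) - d.im * (z.re - p.re) := by
  simp [side, Complex.mul_im]; ring

theorem continuous_side (p d : ℂ) : Continuous (side p d) := by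
  unfold side; fun_prop

theorem side_combo (p d z z' : ℂ) {a b : ℝ} (hab : a + b = 1) :
    side p d (a • z + b • z') = a * side p d z + b * side p d z' := by
  obtain rfl : a = 1 - b := by linarith
  simp [side_eq]
  ring

theorem side_self (p d : ℂ) : side p d p = 0 := by simp [side]

theorem side_add_mul (p d : ℂ) (s : ℝ) : side p d (p + s * d) = 0 := by
  simp [side_eq]; ring

theorem eq_add_mul_of_side_eq_zero {p d z : ℂ} (hd : ‖d‖ = 1) (h : side p d z = 0) :
    ∃ s : ℝ, z = p + s * d := by
  have hd1 : d * conj d = 1 := by rw [Complex.mul_conj, Complex.normSq_eq_norm_sq, hd]; simp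
  refine ⟨((z - p) * conj d).re, ?_⟩
  have hs : ((((z - p) * conj d).re : ℝ) : ℂ) = (z - p) * conj d := by
    apply Complex.ext
    · simp
    · rw [Complex.ofReal_im]; exact h.symm
  rw [hs]
  linear_combination (p - z) * hd1

/-- The polygon cut out by the lines through `v i` with direction `d i`. -/
def core (v d : Fin 5 → ℂ) : Set ℂ := {z | ∀ i, 0 ≤ side (v i) (d i) z}

/-- The open polygon cut out by the lines through `v i` with direction `d i`. -/
def openCore (v d : Fin 5 → ℂ) : Set ℂ := {z | ∀ i, 0 < side (v i) (d i) z}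

theorem convex_core (v d : Fin 5 → ℂ) : Convex ℝ (core v d) := by
  intro z hz z' hz' a b ha hb hab i
  rw [side_combo _ _ _ _ hab]
  exact add_nonneg (mul_nonneg ha (hz i)) (mul_nonneg hb (hz' i))

theorem isClosed_core (v d : Fin 5 → ℂ) : IsClosed (core v d) := by
  simp only [core, ofPred_forall]
  exact isClosed_iInter fun i => isClosed_le continuous_const (continuous_side _ _)

theorem isOpen_openCore (v d : Fin 5 → ℂ) : IsOpen (openCore v d) := by
  simp only [openCore, ofPred_forall]
  exact isOpen_iInter_of_finite fun i => isOpen_lt continuous_const (continuous_side _ _)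

theorem openCore_subset_core (v d : Fin 5 → ℂ) : openCore v d ⊆ core v d :=
  fun _ hz i => (hz i).le

/-- Constraints that are strict at `p` persist nearby, so only lines through `p` shape the pentagon
locally. -/
theorem core_congr {v d : Fin 5 → ℂ} {p : ℂ} (hp : p ∈ core v d) :
    ∀ᶠ z in 𝓝 p, (∀ i, side (v i) (d i) p = 0 → 0 ≤ side (v i) (d i) z) ↔ z ∈ core v d := by
  have h : ∀ᶠ z in 𝓝 p, ∀ i, side (v i) (d i) p ≠ 0 → 0 < side (v i) (d i) z := by
    rw [eventually_all]
    intro i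
    by_cases hi : side (v i) (d i) p = 0
    · simp [hi]
    · filter_upwards [(continuous_side (v i) (d i)).continuousAt.eventually (lt_mem_nhds <|
        lt_of_le_of_ne (hp i) (Ne.symm hi))] with z hz _ using hz
  filter_upwards [h] with z hz
  refine ⟨fun hz' i => ?_, fun hz' i _ => hz' i⟩
  by_cases hi : side (v i) (d i) p = 0
  · exact hz' i hi
  · exact (hz i hi).le

/-- Vertices `v i`, directions `d i` and lengths `l i` of the edges of a strictly convex pentagon
with positive orientation. -/
structure IsConvexPentagon (v d : Fin 5 → ℂ) (l : Fin 5 → ℝ) : Prop where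
  norm_dir : ∀ i, ‖d i‖ = 1
  length_pos : ∀ i, 0 < l i
  succ : ∀ i, v (i + 1) = v i + l i * d i
  side_pos : ∀ i j, j ≠ i → j ≠ i + 1 → 0 < side (v i) (d i) (v j)

namespace IsConvexPentagon

variable {v d : Fin 5 → ℂ} {l : Fin 5 → ℝ}

theorem side_succ (h : IsConvexPentagon v d l) (i : Fin 5) : side (v i) (d i) (v (i + 1)) = 0 := by
  rw [h.succ, side_add_mul]

theorem side_nonneg (h : IsConvexPentagon v d l) (i j : Fin 5) : 0 ≤ side (v i) (d i) (v j) := by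
  by_cases h1 : j = i
  · rw [h1, side_self]
  · by_cases h2 : j = i + 1
    · rw [h2, h.side_succ]
    · exact (h.side_pos i j h1 h2).le

theorem vertex_mem (h : IsConvexPentagon v d l) (j : Fin 5) : v j ∈ core v d :=
  fun i => h.side_nonneg i j

/-- The half-planes of the preceding and the following edge cut the line of the edge `i` down to the
edge itself. -/
theorem exists_mem_segment (h : IsConvexPentagon v d l) {z : ℂ} (hz : z ∈ core v d) {i : Fin 5}
    (hi : side (v i) (d i) z = 0) :
    ∃ t : ℝ, 0 ≤ t ∧ t ≤ 1 ∧ z = (1 - t) • v i + t • v (i + 1) := by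
  obtain ⟨s, rfl⟩ := eq_add_mul_of_side_eq_zero (h.norm_dir i) hi
  have hl := h.length_pos i
  have hlc : (l i : ℂ) ≠ 0 := by exact_mod_cast hl.ne'
  have hz' : v i + s * d i = (1 - s / l i) • v i + (s / l i) • v (i + 1) := by
    rw [h.succ]
    simp only [Complex.real_smul]
    push_cast
    field_simp
    ring
  refine ⟨s / l i, ?_, ?_, hz'⟩
  -- `i + 4` is the predecessor of `i` in `Fin 5`.
  · have h1 : 0 < side (v (i + 4)) (d (i + 4)) (v (i + 1)) :=
      h.side_pos _ _ (by clear * -; decide +revert) (by clear * -; decide +revert)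
    have h2 := hz (i + 4)
    have h3 := h.side_succ (i + 4)
    rw [show i + 4 + 1 = i by clear * -; decide +revert] at h3
    rw [hz', side_combo _ _ _ _ (by ring), h3, mul_zero, zero_add] at h2
    exact nonneg_of_mul_nonneg_left h2 h1
  · have h1 : 0 < side (v (i + 1)) (d (i + 1)) (v i) :=
      h.side_pos _ _ (by clear * -; decide +revert) (by clear * -; decide +revert)
    have h2 := hz (i + 1)
    rw [hz', side_combo _ _ _ _ (by ring), side_self, mul_zero, add_zero] at h2
    linarith [nonneg_of_mul_nonneg_left h2 h1]

theorem iUnion_segment (h : IsConvexPentagon v d l) :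
    ⋃ i, segment ℝ (v i) (v (i + 1)) = core v d \ openCore v d := by
  ext z
  simp only [mem_iUnion, Set.mem_sdiff]
  constructor
  · rintro ⟨i, hi⟩
    refine ⟨(convex_core v d).segment_subset (h.vertex_mem _) (h.vertex_mem _) hi, fun ho => ?_⟩
    obtain ⟨a, b, -, -, hab, rfl⟩ := hi
    have := ho i
    rw [side_combo _ _ _ _ hab, side_self, h.side_succ] at this
    simp at this
  · rintro ⟨hz, ho⟩
    obtain ⟨i, hi⟩ := not_forall.1 ho
    obtain ⟨t, h0, h1, rfl⟩ := h.exists_mem_segment hz (le_antisymm (not_lt.1 hi) (hz i))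
    exact ⟨i, 1 - t, t, by linarith, h0, by ring, rfl⟩

/-- The hypothesis `hθ` says that the outgoing direction, turned by `θ`, is the reversed incoming
one; locally only these two edges matter. -/
theorem hasAngle_vertex (h : IsConvexPentagon v d l) {θ : ℝ} (h0 : 0 ≤ θ) (hπ : θ ≤ π) (j : Fin 5)
    (hθ : d (j + 1) * Complex.exp (θ * Complex.I) = -d j) : HasAngle (core v d) (v (j + 1)) θ := by
  refine (hasAngle_sector h0 hπ (v (j + 1)) (h.norm_dir (j + 1))).congr ?_
  filter_upwards [core_congr (h.vertex_mem (j + 1))] with z hz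
  have hj : side (v j) (d j) z = side (v (j + 1)) (d j) z := by
    rw [h.succ, side_eq, side_eq]; simp; ring
  rw [← hz, hθ, map_neg, mul_neg, Complex.neg_im, neg_nonpos]
  change 0 ≤ side (v (j + 1)) (d (j + 1)) z ∧ 0 ≤ side (v (j + 1)) (d j) z ↔ _
  rw [← hj]
  refine ⟨fun ⟨ha, hb⟩ i hi => ?_, fun H => ⟨H _ (side_self _ _), H _ (h.side_succ j)⟩⟩
  by_cases h1 : j + 1 = i
  · rwa [← h1]
  · by_cases h2 : j = i
    · rwa [← h2]
    · exact absurd hi (h.side_pos i (j + 1) h1 (fun h => h2 (add_right_cancel h))).ne'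

/-- The angle of a strictly convex pentagon at one of its points is a full, straight, or interior
angle. -/
theorem exists_hasAngle (h : IsConvexPentagon v d l) {θ : Fin 5 → ℝ} (h0 : ∀ i, 0 ≤ θ i)
    (hπ : ∀ i, θ i ≤ π)
    (hθ : ∀ j, d (j + 1) * Complex.exp (θ (j + 1) * Complex.I) = -d j) {p : ℂ}
    (hp : p ∈ core v d) :
    ∃ w, HasAngle (core v d) p w ∧ (w = 2 * π ∨ w = π ∨ ∃ i, w = θ i) := by
  have hvert : ∀ i, HasAngle (core v d) (v i) (θ i) := by
    intro i
    obtain ⟨j, rfl⟩ : ∃ j, i = j + 1 := ⟨i - 1, (sub_add_cancel i 1).symm⟩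
    exact h.hasAngle_vertex (h0 _) (hπ _) j (hθ j)
  by_cases ho : p ∈ openCore v d
  · exact ⟨_, hasAngle_of_mem_nhds (mem_of_superset ((isOpen_openCore v d).mem_nhds ho)
      (openCore_subset_core v d)), Or.inl rfl⟩
  · obtain ⟨i, hi⟩ := not_forall.1 ho
    have hi : side (v i) (d i) p = 0 := le_antisymm (not_lt.1 hi) (hp i)
    obtain ⟨t, ht0, ht1, rfl⟩ := h.exists_mem_segment hp hi
    rcases ht0.eq_or_lt with rfl | ht0
    · exact ⟨θ i, by simpa using hvert i, Or.inr (Or.inr ⟨i, rfl⟩)⟩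
    rcases ht1.eq_or_lt with rfl | ht1
    · exact ⟨θ (i + 1), by simpa using hvert (i + 1), Or.inr (Or.inr ⟨i + 1, rfl⟩)⟩
    refine ⟨π, (hasAngle_halfPlane _ (h.norm_dir i)).congr ?_, Or.inr (Or.inl rfl)⟩
    filter_upwards [core_congr hp] with z hz
    rw [← hz]
    set p := (1 - t) • v i + t • v (i + 1) with hpdef
    have hside : side (v i) (d i) z = side p (d i) z := by
      have : side (v i) (d i) z = side p (d i) z + side (v i) (d i) p := by
        simp only [side_eq]; ring
      rw [this, hi, add_zero]
    change 0 ≤ side p (d i) z ↔ _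
    rw [← hside]
    refine ⟨fun H j hj => ?_, fun H => H i hi⟩
    by_cases hij : j = i
    · rwa [hij]
    exfalso
    rw [hpdef, side_combo _ _ _ _ (by ring)] at hj
    have hs1 := mul_nonneg (sub_nonneg.2 ht1.le) (h.side_nonneg j i)
    have hs2 := mul_nonneg ht0.le (h.side_nonneg j (i + 1))
    -- On a line other than that of the edge `i`, at most one end of this edge can lie. The other
    -- end is strictly inside, hence so is `p`.
    by_cases hij' : i = j + 1
    · have : 0 < side (v j) (d j) (v (i + 1)) :=
        h.side_pos _ _ (by rw [hij']; clear * -; decide +revert) (by rw [hij']; clear * -; decide +revert)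
      have := mul_pos ht0 this
      linarith
    · have := mul_pos (sub_pos.2 ht1) (h.side_pos j i (Ne.symm hij) hij')
      linarith

end IsConvexPentagon

end PentagonTiling

end

section

open MeasureTheory Set Filter Topology
open scoped ComplexConjugate ENNReal Real

namespace PentagonTiling

/-! ### A rectangle whose long side is bent at its midpoint -/

/-- Edge lengths of the bent rectangle. -/
noncomputable def houseLength (φ : ℝ) : Fin 5 → ℝ := ![2 * Real.cos (2 * φ) - 2 * Real.sin φ, 1, 1, 1, 1]

/-- Angles of the bent rectangle. -/
noncomputable def houseAngle (φ : ℝ) : Fin 5 → ℝ := ![π / 2 + φ, π / 2 + φ, π / 2 + φ, π - 4 * φ, π / 2 + φ]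

/-- Directions of the edges of the bent rectangle. -/
noncomputable def houseDir (φ : ℝ) : Fin 5 → ℂ :=
  ![⟨1, 0⟩, ⟨Real.sin φ, Real.cos φ⟩, ⟨-Real.cos (2 * φ), Real.sin (2 * φ)⟩,
    ⟨-Real.cos (2 * φ), -Real.sin (2 * φ)⟩, ⟨Real.sin φ, -Real.cos φ⟩]

/-- Vertices of the bent rectangle. -/
noncomputable def houseVertex (φ : ℝ) : Fin 5 → ℂ :=
  ![⟨0, 0⟩, ⟨2 * Real.cos (2 * φ) - 2 * Real.sin φ, 0⟩,
    ⟨2 * Real.cos (2 * φ) - Real.sin φ, Real.cos φ⟩,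
    ⟨Real.cos (2 * φ) - Real.sin φ, Real.cos φ + Real.sin (2 * φ)⟩,
    ⟨-Real.sin φ, Real.cos φ⟩]

theorem heading_add_one (θ : Fin 5 → ℝ) {j : Fin 5} (hj : j.val + 1 < 5) :
    heading θ (j + 1) = heading θ j + (π - θ (j + 1)) := by
  have hval : (j + 1).val = j.val + 1 := Fin.val_add_one_of_lt' hj
  have h : (Finset.univ.filter fun k : Fin 5 => 0 < k.val ∧ k ≤ j + 1) =
      insert (j + 1) (Finset.univ.filter fun k : Fin 5 => 0 < k.val ∧ k ≤ j) := by
    ext k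
    simp only [Finset.mem_filter, Finset.mem_univ, true_and, Finset.mem_insert, Fin.ext_iff,
      Fin.le_def, hval]
    omega
  have hn : j + 1 ∉ Finset.univ.filter fun k : Fin 5 => 0 < k.val ∧ k ≤ j := by
    simp only [Finset.mem_filter, Finset.mem_univ, true_and, Fin.le_def, hval]
    omega
  rw [heading, h, Finset.sum_insert hn, heading, add_comm]

theorem exp_heading (φ : ℝ) (i : Fin 5) :
    Complex.exp (heading (houseAngle φ) i * Complex.I) = houseDir φ i := by
  have h0 : heading (houseAngle φ) 0 = 0 := by
    rw [heading, Finset.filter_eq_empty_iff.2, Finset.sum_empty]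
    intro j _ hj
    have := Fin.le_def.1 hj.2
    simp only [Fin.val_zero] at this
    omega
  have h1 : heading (houseAngle φ) 1 = π / 2 - φ := by
    rw [show (1 : Fin 5) = 0 + 1 from rfl, heading_add_one _ (by decide), h0]
    simp [houseAngle]; ring
  have h2 : heading (houseAngle φ) 2 = π - 2 * φ := by
    rw [show (2 : Fin 5) = 1 + 1 from rfl, heading_add_one _ (by decide), h1]
    simp [houseAngle]; ring
  have h3 : heading (houseAngle φ) 3 = 2 * φ + π := by
    rw [show (3 : Fin 5) = 2 + 1 from rfl, heading_add_one _ (by decide), h2]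
    simp [houseAngle]; ring
  have h4 : heading (houseAngle φ) 4 = φ + π / 2 + π := by
    rw [show (4 : Fin 5) = 3 + 1 from rfl, heading_add_one _ (by decide), h3]
    simp [houseAngle]; ring
  apply Complex.ext
  · rw [Complex.exp_ofReal_mul_I_re]
    fin_cases i
    · simp [h0, houseDir]
    · simp [h1, houseDir, Real.cos_pi_div_two_sub]
    · simp [h2, houseDir, Real.cos_pi_sub]
    · simp [h3, houseDir, Real.cos_add_pi]
    · simp [h4, houseDir, Real.cos_add_pi, Real.cos_add_pi_div_two]
  · rw [Complex.exp_ofReal_mul_I_im]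
    fin_cases i
    · simp [h0, houseDir]
    · simp [h1, houseDir, Real.sin_pi_div_two_sub]
    · simp [h2, houseDir, Real.sin_pi_sub]
    · simp [h3, houseDir, Real.sin_add_pi]
    · simp [h4, houseDir, Real.sin_add_pi, Real.sin_add_pi_div_two]

theorem houseVertex_succ (φ : ℝ) (i : Fin 5) :
    houseVertex φ (i + 1) = houseVertex φ i + houseLength φ i * houseDir φ i := by
  apply Complex.ext
  · rw [Complex.add_re, Complex.re_ofReal_mul]
    fin_cases i <;> simp [houseVertex, houseLength, houseDir] <;> ring
  · rw [Complex.add_im, Complex.im_ofReal_mul]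
    fin_cases i <;> simp [houseVertex, houseLength, houseDir]

theorem vertex_succ {n : ℕ} (L θ : Fin n → ℝ) (i : Fin n) :
    vertex L θ (i.val + 1) = vertex L θ i.val + L i * Complex.exp (heading θ i * Complex.I) := by
  have h : (Finset.univ.filter fun j : Fin n => j.val < i.val + 1) =
      insert i (Finset.univ.filter fun j : Fin n => j.val < i.val) := by
    ext j
    simp [Fin.ext_iff]
    omega
  rw [vertex, h, Finset.sum_insert (by simp), add_comm, vertex]

theorem vertex_zero {n : ℕ} (L θ : Fin n → ℝ) : vertex L θ 0 = 0 := by simp [vertex]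

theorem vertex_house (φ : ℝ) (i : Fin 5) :
    vertex (houseLength φ) (houseAngle φ) i.val = houseVertex φ i := by
  have step : ∀ i : Fin 5, vertex (houseLength φ) (houseAngle φ) i.val = houseVertex φ i →
      vertex (houseLength φ) (houseAngle φ) (i.val + 1) = houseVertex φ (i + 1) := by
    intro i h
    rw [vertex_succ, h, exp_heading, houseVertex_succ]
  have h0 : vertex (houseLength φ) (houseAngle φ) (0 : Fin 5).val = houseVertex φ 0 := by
    simp only [Fin.val_zero, vertex_zero]; rfl
  have h1 := step 0 h0
  have h2 := step 1 h1
  have h3 := step 2 h2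
  have h4 := step 3 h3
  fin_cases i
  exacts [h0, h1, h2, h3, h4]

theorem vertex_house_succ (φ : ℝ) (i : Fin 5) :
    vertex (houseLength φ) (houseAngle φ) (i.val + 1) = houseVertex φ (i + 1) := by
  rw [vertex_succ, vertex_house, exp_heading, houseVertex_succ]

theorem boundary_house (φ : ℝ) : boundary (houseLength φ) (houseAngle φ) =
    ⋃ i, segment ℝ (houseVertex φ i) (houseVertex φ (i + 1)) := by
  simp only [boundary, vertex_house, vertex_house_succ]

theorem houseDir_mul_exp (φ : ℝ) (j : Fin 5) :
    houseDir φ (j + 1) * Complex.exp (houseAngle φ (j + 1) * Complex.I) = -houseDir φ j := by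
  have key : ∀ a b c : ℝ, a + b = c + π → Complex.exp (a * Complex.I) * Complex.exp (b * Complex.I) =
      -Complex.exp (c * Complex.I) := by
    intro a b c h
    rw [← Complex.exp_add, ← add_mul, ← Complex.ofReal_add, h]
    push_cast
    rw [add_mul, Complex.exp_add, Complex.exp_pi_mul_I]
    ring
  -- The closing vertex is checked by hand, because `heading` never uses the angle at vertex `0`.
  by_cases hj : j = 4
  · subst hj
    rw [show (4 : Fin 5) + 1 = 0 from rfl]
    apply Complex.ext
    · simp only [Complex.mul_re, Complex.exp_ofReal_mul_I_re, Complex.exp_ofReal_mul_I_im]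
      simp [houseDir, houseAngle, add_comm (π / 2), Real.cos_add_pi_div_two]
    · simp only [Complex.mul_im, Complex.exp_ofReal_mul_I_re, Complex.exp_ofReal_mul_I_im]
      simp [houseDir, houseAngle, add_comm (π / 2), Real.sin_add_pi_div_two]
  · rw [← exp_heading, ← exp_heading]
    refine key _ _ _ ?_
    have hlt : j.val + 1 < 5 := by have := j.isLt; have := Fin.val_ne_of_ne hj; simp at this; omega
    rw [heading_add_one _ hlt]
    ring

/-- Sines and cosines of small angles. -/
theorem small_angle {φ : ℝ} (h0 : 0 ≤ φ) (h1 : φ ≤ 1 / 5) :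
    0 ≤ Real.sin φ ∧ Real.sin φ ≤ 1 / 5 ∧ 1 / 2 < Real.cos φ ∧ 1 / 2 < Real.cos (2 * φ) ∧
      0 ≤ Real.sin (2 * φ) := by
  have hπ := Real.pi_gt_three
  refine ⟨Real.sin_nonneg_of_nonneg_of_le_pi h0 (by linarith), (Real.sin_le h0).trans h1, ?_, ?_,
    Real.sin_nonneg_of_nonneg_of_le_pi (by linarith) (by linarith)⟩
  · have := Real.one_sub_sq_div_two_le_cos (x := φ); nlinarith
  · have := Real.one_sub_sq_div_two_le_cos (x := 2 * φ); nlinarith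

/-- Strict convexity needs `φ > 0`: for `φ = 0` the vertices `2`, `3`, `4` are collinear, and the
rectangle is treated separately. -/
theorem isConvexPentagon_house {φ : ℝ} (h0 : 0 < φ) (h1 : φ ≤ 1 / 5) :
    IsConvexPentagon (houseVertex φ) (houseDir φ) (houseLength φ) := by
  obtain ⟨hx, hx1, hc, hk, hh⟩ := small_angle h0.le h1
  have hh : 0 < Real.sin (2 * φ) :=
    Real.sin_pos_of_pos_of_lt_pi (by linarith) (by linarith [Real.pi_gt_three])
  have n1 := Real.sin_sq_add_cos_sq φ
  have n2 := Real.sin_sq_add_cos_sq (2 * φ)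
  constructor
  · intro i
    rw [← exp_heading, Complex.norm_exp_ofReal_mul_I]
  · intro i
    fin_cases i <;> simp [houseLength]
    linarith
  · exact houseVertex_succ φ
  · set x := Real.sin φ
    set c := Real.cos φ
    set k := Real.cos (2 * φ)
    set h := Real.sin (2 * φ)
    have hxc := mul_nonneg hx (by linarith : 0 ≤ c)
    have hxk := mul_nonneg hx (by linarith : 0 ≤ k)
    have hxh := mul_nonneg hx hh.le
    have hck := mul_pos (by linarith : 0 < c) (by linarith : 0 < k)
    have hkh := mul_pos (by linarith : 0 < k) hh
    have e1 := mul_pos (by linarith : 0 < c) (by linarith : 0 < k - x)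
    have e2 := mul_pos hh (by linarith : 0 < k - x)
    intro i j hj hj'
    rw [side_eq]
    fin_cases i <;> fin_cases j <;>
      simp [houseVertex, houseDir] at hj hj' ⊢ <;> first | exact absurd rfl hj' | nlinarith

theorem isBounded_core_house {φ : ℝ} (h0 : 0 ≤ φ) (h1 : φ ≤ 1 / 5) :
    Bornology.IsBounded (core (houseVertex φ) (houseDir φ)) := by
  obtain ⟨hx, hx1, hc, hk, hh⟩ := small_angle h0 h1
  rw [isBounded_iff_forall_norm_le]
  refine ⟨30, fun z hz => ?_⟩
  have s0 := hz 0
  have s1 := hz 1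
  have s2 := hz 2
  have s3 := hz 3
  have s4 := hz 4
  simp only [side_eq] at s0 s1 s2 s3 s4
  simp [houseVertex, houseDir] at s0 s1 s2 s3 s4
  have hc1 := Real.cos_le_one φ
  have hk1 := Real.cos_le_one (2 * φ)
  have hh1 := Real.sin_le_one (2 * φ)
  set x := Real.sin φ
  set c := Real.cos φ
  set k := Real.cos (2 * φ)
  set h := Real.sin (2 * φ)
  -- Adding `s2` and `s3`, the constraints of the two halves of the bent side, cancels `z.re`. Once
  -- the height is bounded, `s1` and `s4` bound `z.re`.
  have him : z.im ≤ c + h := by nlinarith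
  have hre : z.re ≤ 10 := by nlinarith
  have hre' : -10 ≤ z.re := by nlinarith
  refine (Complex.norm_le_abs_re_add_abs_im z).trans ?_
  have := abs_le.2 ⟨hre', hre⟩
  rw [abs_of_nonneg s0]
  linarith

theorem openCore_house_nonempty {φ : ℝ} (h0 : 0 ≤ φ) (h1 : φ ≤ 1 / 5) :
    (openCore (houseVertex φ) (houseDir φ)).Nonempty := by
  obtain ⟨hx, hx1, hc, hk, hh⟩ := small_angle h0 h1
  refine ⟨⟨Real.cos (2 * φ) - Real.sin φ, Real.cos φ / 2⟩, fun i => ?_⟩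
  rw [side_eq]
  set x := Real.sin φ
  set c := Real.cos φ
  set k := Real.cos (2 * φ)
  set h := Real.sin (2 * φ)
  have hxc := mul_nonneg hx (by linarith : 0 ≤ c)
  have hck := mul_pos (by linarith : 0 < c) (by linarith : 0 < k)
  have hkh := mul_nonneg (by linarith : 0 ≤ k) hh
  have e1 := mul_pos (by linarith : 0 < c) (by linarith : 0 < k - x)
  fin_cases i <;> simp [houseVertex, houseDir] <;> nlinarith

theorem region_house {φ : ℝ} (h0 : 0 < φ) (h1 : φ ≤ 1 / 5) :
    region (houseLength φ) (houseAngle φ) = core (houseVertex φ) (houseDir φ) :=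
  region_eq_of_boundary_eq (convex_core _ _)
    (Metric.isCompact_of_isClosed_isBounded (isClosed_core _ _) (isBounded_core_house h0.le h1))
    ((openCore_house_nonempty h0.le h1).mono (openCore_subset_core _ _)) (isOpen_openCore _ _)
    (openCore_subset_core _ _)
    ((boundary_house φ).trans (isConvexPentagon_house h0 h1).iUnion_segment)

end PentagonTiling

end

/-! ### The promise, the tiling rectangle and the non-tiling pentagons -/

section

open MeasureTheory Set Filter Topology
open scoped ComplexConjugate ENNReal Real

namespace PentagonTiling

theorem disjoint_image_lineMap {a b a' b' : ℂ}
    (h : ∀ s t : ℝ, 0 ≤ s → s < 1 → 0 ≤ t → t < 1 →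
      a.re + s * (b.re - a.re) = a'.re + t * (b'.re - a'.re) →
      a.im + s * (b.im - a.im) = a'.im + t * (b'.im - a'.im) → False) :
    Disjoint (AffineMap.lineMap (k := ℝ) a b '' Ico 0 1)
      (AffineMap.lineMap (k := ℝ) a' b' '' Ico 0 1) := by
  rw [disjoint_left]
  rintro _ ⟨s, hs, rfl⟩ ⟨t, ht, h'⟩
  refine h s t hs.1 hs.2 ht.1 ht.2 ?_ ?_
  · have := congrArg Complex.re h'
    simp [AffineMap.lineMap_apply] at this
    linarith
  · have := congrArg Complex.im h'
    simp [AffineMap.lineMap_apply] at this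
    linarith

/-- The promise has to hold for `φ = 0` as well, so disjointness of edges is derived from
coordinates and not from strict convexity. -/
theorem isSimpleClosedPolygon_house {φ : ℝ} (h0 : 0 ≤ φ) (h1 : φ ≤ 1 / 5) :
    IsSimpleClosedPolygon (houseLength φ) (houseAngle φ) := by
  obtain ⟨hx, hx1, hc, hk, hh⟩ := small_angle h0 h1
  have hπ := Real.pi_gt_three
  constructor
  · norm_num
  · intro i
    fin_cases i <;> simp [houseLength]
    linarith
  · intro i
    fin_cases i <;> simp [houseAngle] <;> linarith
  · intro i
    fin_cases i <;> simp [houseAngle] <;> linarith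
  · simp [Fin.sum_univ_succ, houseAngle]
    ring
  · have := vertex_house_succ φ 4
    rw [vertex_zero]
    exact this
  · have hlt : ∀ i j : Fin 5, i < j → Disjoint (halfOpenEdge (houseLength φ) (houseAngle φ) i)
        (halfOpenEdge (houseLength φ) (houseAngle φ) j) := by
      intro i j hij
      simp only [halfOpenEdge, vertex_house, vertex_house_succ]
      refine disjoint_image_lineMap fun s t hs hs1 ht ht1 hre him => ?_
      set x := Real.sin φ with hxd
      set c := Real.cos φ with hcd
      set k := Real.cos (2 * φ) with hkd
      set h := Real.sin (2 * φ) with hhd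
      have g1 := mul_nonneg hs hx
      have g2 := mul_nonneg hs hh
      have g3 := mul_nonneg ht hh
      have g4 := mul_nonneg (sub_nonneg.2 ht1.le) hh
      have g5 := mul_nonneg (sub_nonneg.2 ht1.le) hx
      have g6 : 0 < (1 - t) * c := mul_pos (sub_pos.2 ht1) (by linarith)
      have g7 : 0 < (1 - s) * c := mul_pos (sub_pos.2 hs1) (by linarith)
      have g8 : 0 < (1 - s) * k := mul_pos (sub_pos.2 hs1) (by linarith)
      have g9 : 0 < (1 - s) * (k - x) := mul_pos (sub_pos.2 hs1) (by linarith)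
      have g10 : 0 ≤ t * k := mul_nonneg ht (by linarith)
      have g11 : 0 ≤ t * c := mul_nonneg ht (by linarith)
      have g12 : 0 ≤ (1 - s) * h := mul_nonneg (sub_nonneg.2 hs1.le) hh
      have g13 := mul_nonneg ht hx
      fin_cases i <;> fin_cases j <;> first
        | exact absurd hij (by decide)
        | skip
      all_goals simp [houseVertex, ← hxd, ← hcd, ← hkd, ← hhd] at hre him
      · rcases him with rfl | hc0
        · nlinarith
        · linarith
      all_goals nlinarith
    intro i j hij
    rcases lt_or_gt_of_ne hij with h | h
    · exact hlt i j h
    · exact (hlt j i h).symm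

/-! ### The unbent rectangle tiles the plane -/

theorem boundary_house_zero : boundary (houseLength 0) (houseAngle 0) =
    (Icc 0 2 ×ℂ Icc 0 1) \ (Ioo 0 2 ×ℂ Ioo 0 1) := by
  have hv : houseVertex 0 = ![⟨0, 0⟩, ⟨2, 0⟩, ⟨2, 1⟩, ⟨1, 1⟩, ⟨0, 1⟩] := by simp [houseVertex]
  have hseg : ∀ a b z : ℂ, z ∈ segment ℝ a b ↔ ∃ t : ℝ, 0 ≤ t ∧ t ≤ 1 ∧
      z.re = a.re + t * (b.re - a.re) ∧ z.im = a.im + t * (b.im - a.im) := by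
    intro a b z
    rw [segment_eq_image']
    constructor
    · rintro ⟨t, ht, rfl⟩
      exact ⟨t, ht.1, ht.2, by simp, by simp⟩
    · rintro ⟨t, h0, h1, hr, hi⟩
      exact ⟨t, ⟨h0, h1⟩, Complex.ext (by simp [hr]) (by simp [hi])⟩
  rw [boundary_house, hv]
  ext z
  simp only [mem_iUnion, hseg, Set.mem_sdiff, Complex.mem_reProdIm, mem_Icc, mem_Ioo]
  constructor
  · rintro ⟨i, t, h0, h1, hr, hi⟩
    fin_cases i <;> simp at hr hi <;> rw [hr, hi] <;>
      refine ⟨⟨⟨?_, ?_⟩, ?_, ?_⟩, ?_⟩ <;> first | linarith | (rintro ⟨⟨a, b⟩, a', b'⟩; linarith)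
  · rintro ⟨⟨⟨a, b⟩, a', b'⟩, hn⟩
    by_cases c1 : z.im = 0
    · exact ⟨0, z.re / 2, by linarith, by linarith, by simp, by simp [c1]⟩
    by_cases c2 : z.re = 2
    · exact ⟨1, z.im, a', b', by simp [c2], by simp⟩
    by_cases c3 : z.re = 0
    · exact ⟨4, 1 - z.im, by linarith, by linarith, by simp [c3], by simp⟩
    have c4 : z.im = 1 := by
      by_contra c4
      exact hn ⟨⟨lt_of_le_of_ne a (Ne.symm c3), lt_of_le_of_ne b c2⟩,
        lt_of_le_of_ne a' (Ne.symm c1), lt_of_le_of_ne b' c4⟩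
    by_cases c5 : 1 ≤ z.re
    · exact ⟨2, 2 - z.re, by linarith, by linarith, by simp; ring, by simp [c4]⟩
    · exact ⟨3, 1 - z.re, by linarith, by linarith, by simp, by simp [c4]⟩

theorem region_house_zero : region (houseLength 0) (houseAngle 0) = Icc 0 2 ×ℂ Icc 0 1 := by
  refine region_eq_of_boundary_eq ?_ (isCompact_Icc.reProdIm isCompact_Icc)
    ⟨0, by simp [Complex.mem_reProdIm]⟩ (isOpen_Ioo.reProdIm isOpen_Ioo) ?_ boundary_house_zero
  · exact ((convex_Icc _ _).linear_preimage Complex.reLm).inter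
      ((convex_Icc _ _).linear_preimage Complex.imLm)
  · exact inter_subset_inter (preimage_mono Ioo_subset_Icc_self) (preimage_mono Ioo_subset_Icc_self)

theorem TilesPlane.mono {G G' : Set (ℂ ≃ᵢ ℂ)} (hG : G ⊆ G') {P : Set ℂ} (h : TilesPlane G P) :
    TilesPlane G' P := by
  obtain ⟨𝒯, h1, h2⟩ := h
  exact ⟨𝒯, fun T hT => (h1 T hT).imp fun g hg => ⟨hG hg.1, hg.2⟩, h2⟩

theorem disjoint_Ioo_of_int {a b : ℤ} (h : a ≠ b) (ℓ : ℝ) (hℓ : 0 < ℓ) :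
    Disjoint (Ioo (ℓ * a) (ℓ * a + ℓ)) (Ioo (ℓ * b) (ℓ * b + ℓ)) := by
  rw [disjoint_left]
  rintro x ⟨h1, h2⟩ ⟨h3, h4⟩
  have e1 : ℓ * a < ℓ * (b + 1) := by linarith
  have e2 : ℓ * b < ℓ * (a + 1) := by linarith
  have e1' : (a : ℝ) < ((b + 1 : ℤ) : ℝ) := by push_cast; exact lt_of_mul_lt_mul_left e1 hℓ.le
  have e2' : (b : ℝ) < ((a + 1 : ℤ) : ℝ) := by push_cast; exact lt_of_mul_lt_mul_left e2 hℓ.le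
  rw [Int.cast_lt] at e1' e2'
  omega

theorem exists_int_mem_Icc (ℓ x : ℝ) (hℓ : 0 < ℓ) : ∃ a : ℤ, x ∈ Icc (ℓ * a) (ℓ * a + ℓ) := by
  refine ⟨⌊x / ℓ⌋, ?_, ?_⟩
  · have := Int.floor_le (x / ℓ); rwa [le_div_iff₀ hℓ, mul_comm] at this
  · have := (Int.lt_floor_add_one (x / ℓ)).le
    rw [div_le_iff₀ hℓ] at this
    linarith

/-- Translations suffice, so one tiling serves with and without reflections. -/
theorem tilesPlane_rectangle : TilesPlane properMotions (Icc 0 2 ×ℂ Icc 0 1) := by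
  let R : ℤ × ℤ → Set ℂ := fun m => Icc ((2 : ℝ) * m.1) (2 * m.1 + 2) ×ℂ
    Icc ((1 : ℝ) * m.2) (1 * m.2 + 1)
  refine ⟨range R, ?_, ?_, ?_⟩
  · rintro _ ⟨m, rfl⟩
    refine ⟨IsometryEquiv.addRight ((⟨2 * m.1, m.2⟩ : ℂ)), ⟨1, ⟨2 * m.1, m.2⟩, by simp, by simp⟩, ?_⟩
    ext z
    simp only [R, IsometryEquiv.addRight_apply, Complex.mem_reProdIm, mem_Icc, one_mul, mem_image]
    constructor
    · rintro ⟨⟨a, b⟩, c, d⟩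
      refine ⟨z - ⟨2 * m.1, m.2⟩, ?_, by simp⟩
      simp
      refine ⟨⟨a, by linarith⟩, c, by linarith⟩
    · rintro ⟨y, ⟨⟨a, b⟩, c, d⟩, rfl⟩
      simp
      exact ⟨⟨a, by linarith⟩, c, by linarith⟩
  · refine eq_univ_of_forall fun z => ?_
    obtain ⟨a, ha⟩ := exists_int_mem_Icc 2 z.re two_pos
    obtain ⟨b, hb⟩ := exists_int_mem_Icc 1 z.im one_pos
    exact ⟨R (a, b), ⟨(a, b), rfl⟩, ha, hb⟩
  · rintro _ ⟨m, rfl⟩ _ ⟨m', rfl⟩ hne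
    have hmm : m.1 ≠ m'.1 ∨ m.2 ≠ m'.2 := by
      by_contra! h
      exact hne (congrArg R (Prod.ext h.1 h.2))
    simp only [R, Complex.interior_reProdIm, interior_Icc]
    rcases hmm with h | h
    · exact ((disjoint_Ioo_of_int h 2 two_pos).preimage Complex.re).mono inter_subset_left
        inter_subset_left
    · exact ((disjoint_Ioo_of_int h 1 one_pos).preimage Complex.im).mono inter_subset_right
        inter_subset_right

/-! ### The bent rectangle does not tile the plane -/

/-- Full, straight and interior angles of the bent rectangle around a bend do not sum to `2 * π`. -/
theorem sum_house_angles_ne {φ : ℝ} (h0 : 0 < φ) (h1 : φ ≤ 1 / 5) {ι : Type*} (s : Finset ι)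
    {w : ι → ℝ} (hw : ∀ i ∈ s, w i = 2 * π ∨ w i = π ∨ w i = π / 2 + φ ∨ w i = π - 4 * φ) {i₀ : ι}
    (hi₀ : i₀ ∈ s) (hw₀ : w i₀ = π - 4 * φ) : ∑ i ∈ s, w i ≠ 2 * π := by
  classical
  intro hsum
  have hπ := Real.pi_gt_three
  rw [← Finset.add_sum_erase s w hi₀, hw₀] at hsum
  set t := s.erase i₀
  have ht : ∀ i ∈ t, w i = 2 * π ∨ w i = π ∨ w i = π / 2 + φ ∨ w i = π - 4 * φ :=
    fun i hi => hw i (Finset.mem_of_mem_erase hi)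
  have hge : ∀ i ∈ t, π / 2 + φ ≤ w i := by
    intro i hi
    rcases ht i hi with h | h | h | h <;> rw [h] <;> linarith
  have hcard := Finset.card_nsmul_le_sum t w _ hge
  rw [nsmul_eq_mul] at hcard
  -- The angles still needed sum to `π + 4φ`, which is less than `3 (π / 2 + φ)`.
  have hc : t.card < 3 := by
    by_contra! h3
    have : (3 : ℝ) ≤ t.card := by exact_mod_cast h3
    nlinarith
  interval_cases hcd : t.card
  · rw [Finset.card_eq_zero.1 hcd, Finset.sum_empty] at hsum
    linarith
  · obtain ⟨a, ha⟩ := Finset.card_eq_one.1 hcd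
    rw [ha, Finset.sum_singleton] at hsum
    rcases ht a (by simp [ha]) with h | h | h | h <;> linarith
  -- Two angles `π / 2 + φ` fall short by `2φ`. The case that limits `φ` is `π / 2 + φ` with `π -
  -- 4φ`: it would fit for `φ = π / 14`, which exceeds `1/5`.
  · obtain ⟨a, b, hab, hs⟩ := Finset.card_eq_two.1 hcd
    rw [hs, Finset.sum_pair hab] at hsum
    rcases ht a (by simp [hs]) with h | h | h | h <;>
      rcases ht b (by simp [hs]) with h' | h' | h' | h' <;> linarith

/-- The angles are counted at the bent vertex of an arbitrary tile. Areas are invariant under every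
isometry, so `G` plays no role. -/
theorem not_tilesPlane_house {φ : ℝ} (h0 : 0 < φ) (h1 : φ ≤ 1 / 5) (G : Set (ℂ ≃ᵢ ℂ)) :
    ¬ TilesPlane G (region (houseLength φ) (houseAngle φ)) := by
  classical
  rw [region_house h0 h1]
  rintro ⟨𝒯, hT, hcov, hd⟩
  have hπ := Real.pi_gt_three
  have hP := isConvexPentagon_house h0 h1
  set K := core (houseVertex φ) (houseDir φ) with hK
  have hθ : ∀ i, 0 ≤ houseAngle φ i ∧ houseAngle φ i ≤ π := by
    intro i
    fin_cases i <;> simp [houseAngle] <;> constructor <;> linarith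
  have hT' : ∀ T ∈ 𝒯, ∃ g : ℂ ≃ᵢ ℂ, T = g '' K := fun T h => (hT T h).imp fun g hg => hg.2
  obtain ⟨T₀, hT₀, -⟩ : (0 : ℂ) ∈ ⋃₀ 𝒯 := hcov ▸ mem_univ _
  obtain ⟨g₀, hg₀⟩ := hT' T₀ hT₀
  set v := g₀ (houseVertex φ 3) with hv
  have hv₀ : HasAngle T₀ v (π - 4 * φ) := by
    rw [hg₀]
    exact (hP.hasAngle_vertex (hθ 3).1 (hθ 3).2 2 (houseDir_mul_exp φ 2)).image g₀
  -- Prescribing the value at `T₀` avoids proving that angles are unique; `0` is a dummy value for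
  -- sets that are not tiles at `v`.
  have hex : ∀ T, ∃ w, T ∈ 𝒯 → v ∈ T → HasAngle T v w ∧
      (w = 2 * π ∨ w = π ∨ w = π / 2 + φ ∨ w = π - 4 * φ) ∧ (T = T₀ → w = π - 4 * φ) := by
    intro T
    by_cases hTT : T = T₀
    · exact ⟨π - 4 * φ, fun _ _ => ⟨hTT ▸ hv₀, by simp, fun _ => rfl⟩⟩
    by_cases hmem : T ∈ 𝒯 ∧ v ∈ T
    · obtain ⟨g, rfl⟩ := hT' T hmem.1
      obtain ⟨p, hp, hgp⟩ := hmem.2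
      obtain ⟨w, hw, hw'⟩ := hP.exists_hasAngle (fun i => (hθ i).1) (fun i => (hθ i).2)
        (houseDir_mul_exp φ) hp
      refine ⟨w, fun _ _ => ⟨hgp ▸ hw.image g, ?_, fun h => absurd h hTT⟩⟩
      rcases hw' with h | h | ⟨i, rfl⟩
      · exact Or.inl h
      · exact Or.inr (Or.inl h)
      · fin_cases i <;> simp [houseAngle]
    · exact ⟨0, fun h h' => absurd ⟨h, h'⟩ hmem⟩
  choose w hw using hex
  obtain ⟨s, hs, hsum⟩ := sum_angles_eq_two_pi
    (Metric.isCompact_of_isClosed_isBounded (isClosed_core _ _) (isBounded_core_house h0.le h1))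
    (convex_core _ _) ((openCore_house_nonempty h0.le h1).mono
      (interior_maximal (openCore_subset_core _ _) (isOpen_openCore _ _))) hT' hcov hd v
    (w := w) (fun T h h' => ⟨(hw T h h').1, by
      rcases (hw T h h').2.1 with e | e | e | e <;> rw [e] <;> linarith⟩)
  have hvT₀ : v ∈ T₀ := by rw [hg₀]; exact mem_image_of_mem _ (hP.vertex_mem 3)
  exact sum_house_angles_ne h0 h1 s
    (fun T hTs => (hw T ((hs T).1 hTs).1 ((hs T).1 hTs).2).2.1)
    ((hs T₀).2 ⟨hT₀, hvT₀⟩) ((hw T₀ hT₀ hvT₀).2.2 rfl) hsum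

end PentagonTiling

end

/-! ### Computable reals: coding, delayed halting and arctangents -/

section

open Filter Topology
open scoped Real

namespace PentagonTiling

/-! ### Programs for sequences of real numbers -/

theorem primrec_pow : Primrec₂ ((· ^ ·) : ℕ → ℕ → ℕ) := Primrec₂.unpaired'.1 Nat.Primrec.pow

theorem encode_natCast (t : ℕ) : Encodable.encode (t : ℤ) = 2 * t := rfl

/-- A sequence of real numbers with primitive recursive rational approximations is computed by a
primitive recursive sequence of programs. -/
theorem exists_code_of_approx {A B : ℕ → ℕ → ℕ} (hA : Primrec₂ A) (hB : Primrec₂ B) {a : ℕ → ℝ}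
    (h : ∀ m n : ℕ, 1 ≤ n → 0 < B m n ∧ |(A m n : ℝ) / B m n - a m| ≤ 1 / (2 * n)) :
    ∃ f : ℕ → Nat.Partrec.Code, Primrec f ∧ ∀ m, ComputesReal (f m) (a m) := by
  -- This is `n * A / B` rounded to the nearest integer. Rounding costs `1/2`, and the error of `A /
  -- B`, scaled by `n`, another `1/2`.
  let T : ℕ → ℕ → ℕ := fun m n => (2 * n * A m n + B m n) / (2 * B m n)
  have hT : Primrec₂ T := by
    have c2 : Primrec₂ fun _ _ : ℕ => 2 := Primrec₂.const 2
    exact Primrec.nat_div.comp₂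
      (Primrec.nat_add.comp₂ (Primrec.nat_mul.comp₂ (Primrec.nat_mul.comp₂ c2 Primrec₂.right) hA) hB)
      (Primrec.nat_mul.comp₂ c2 hB)
  -- A nonnegative integer `t` is encoded as `2 * t`.
  have hF : Primrec fun k : ℕ => 2 * T k.unpair.1 k.unpair.2 :=
    Primrec.nat_mul.comp (Primrec.const 2)
      (hT.comp (Primrec.fst.comp Primrec.unpair) (Primrec.snd.comp Primrec.unpair))
  obtain ⟨c, hc⟩ := Nat.Partrec.Code.exists_code.1 (Partrec.nat_iff.1 hF.to_comp)
  refine ⟨fun m => c.curry m, (Nat.Partrec.Code.primrec₂_curry.comp (Primrec.const c)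
    Primrec.id), fun m n hn => ⟨(T m n : ℤ), ?_, ?_⟩⟩
  · rw [Nat.Partrec.Code.eval_curry, hc, encode_natCast]
    simp
  · obtain ⟨hB0, hab⟩ := h m n hn
    have hn0 : (0 : ℝ) < n := by exact_mod_cast hn
    have hB0' : (0 : ℝ) < B m n := by exact_mod_cast hB0
    have h1 : T m n * (2 * B m n) ≤ 2 * n * A m n + B m n := Nat.div_mul_le_self _ _
    have h2 : 2 * n * A m n + B m n < T m n * (2 * B m n) + 2 * B m n :=
      Nat.lt_div_mul_add (by omega)
    have h1' : (T m n : ℝ) * (2 * B m n) ≤ 2 * n * A m n + B m n := by exact_mod_cast h1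
    have h2' : (2 * n * A m n + B m n : ℝ) < T m n * (2 * B m n) + 2 * B m n := by exact_mod_cast h2
    obtain ⟨q, hq⟩ : ∃ q : ℝ, (A m n : ℝ) = q * B m n := ⟨A m n / B m n, by field_simp⟩
    rw [hq, mul_div_cancel_right₀ _ hB0'.ne'] at hab
    rw [hq] at h1' h2'
    have h3 : (T m n : ℝ) * 2 ≤ 2 * n * q + 1 := by
      refine le_of_mul_le_mul_right ?_ hB0'; linarith
    have h4 : 2 * n * q + 1 < (T m n : ℝ) * 2 + 2 := by
      refine lt_of_mul_lt_mul_right ?_ hB0'.le; linarith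
    obtain ⟨h5, h6⟩ := abs_le.1 hab
    have e : (n : ℝ) * (1 / (2 * n)) = 1 / 2 := by field_simp
    have h5' := mul_le_mul_of_nonneg_left h5 hn0.le
    have h6' := mul_le_mul_of_nonneg_left h6 hn0.le
    rw [mul_neg, e] at h5'
    rw [e] at h6'
    simp only [Int.cast_natCast]
    constructor
    · rw [div_le_iff₀ hn0]; linarith
    · rw [le_div_iff₀ hn0]; linarith

/-- A `yes` answer may bring its own lengths and angles; this identifies them with those of the
constructed pentagon. -/
theorem computesReal_unique {c : Nat.Partrec.Code} {a b : ℝ} (ha : ComputesReal c a)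
    (hb : ComputesReal c b) : a = b := by
  refine eq_of_forall_dist_le fun ε hε => ?_
  obtain ⟨n, hn⟩ := exists_nat_gt (2 / ε)
  have hn0 : (0 : ℝ) < n := (div_pos two_pos hε).trans hn
  have hn1 : 1 ≤ n := by exact_mod_cast hn0
  obtain ⟨z, hz, h1, h2⟩ := ha n hn1
  obtain ⟨z', hz', h3, h4⟩ := hb n hn1
  obtain rfl := Encodable.encode_injective (Part.mem_unique hz hz')
  have h5 : ((z : ℝ) + 1) / n - (z - 1) / n = 2 / n := by ring
  have h6 : 2 / (n : ℝ) ≤ ε := by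
    rw [div_le_iff₀ hn0]; rw [div_lt_iff₀ hε] at hn; linarith
  rw [Real.dist_eq, abs_le]
  constructor <;> linarith

/-- A computable lower bound for the halting time that is attained in the long run. -/
theorem exists_halting_delay {p : ℕ → Prop} (h : REPred fun n => ¬ p n) :
    ∃ d : ℕ → ℕ → ℕ, Primrec₂ d ∧
      ∀ m, (p m ∧ ∀ N, d m N = N) ∨ (¬ p m ∧ ∃ k, ∀ N, d m N = min N k) := by
  classical
  have h' : Partrec fun n : ℕ => (Part.assert (¬ p n) fun _ => Part.some ()).map fun _ => 0 :=
    h.map (Computable.const 0).to₂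
  obtain ⟨c, hc⟩ := Nat.Partrec.Code.exists_code.1 (Partrec.nat_iff.1 h')
  have hdom : ∀ m, (∃ x, x ∈ c.eval m) ↔ ¬ p m := by
    intro m
    rw [hc]
    simp [Part.mem_assert_iff]
  let b : ℕ → ℕ → Bool := fun m k => (c.evaln k m).isSome
  have hb : Primrec₂ b :=
    Primrec.option_isSome.comp (Nat.Partrec.Code.primrec_evaln.comp
      ((Primrec.snd.pair (Primrec.const c)).pair Primrec.fst))
  have hbmono : ∀ m k k', k ≤ k' → b m k = true → b m k' = true := by
    intro m k k' hk hbk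
    obtain ⟨x, hx⟩ := Option.isSome_iff_exists.1 hbk
    exact Option.isSome_iff_exists.2 ⟨x, Nat.Partrec.Code.evaln_mono hk hx⟩
  have hbex : ∀ m, (∃ k, b m k = true) ↔ ¬ p m := by
    intro m
    rw [← hdom]
    constructor
    · rintro ⟨k, hk⟩
      obtain ⟨x, hx⟩ := Option.isSome_iff_exists.1 hk
      exact ⟨x, Nat.Partrec.Code.evaln_sound hx⟩
    · rintro ⟨x, hx⟩
      obtain ⟨k, hk⟩ := Nat.Partrec.Code.evaln_complete.1 hx
      exact ⟨k, Option.isSome_iff_exists.2 ⟨x, hk⟩⟩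
  -- Counts the bounds below `N` at which the search has not yet succeeded.
  let d : ℕ → ℕ → ℕ := fun m N => N.rec 0 fun k s => bif b m k then s else s + 1
  have hsucc : ∀ m N, d m (N + 1) = bif b m N then d m N else d m N + 1 := fun _ _ => rfl
  refine ⟨d, ?_, fun m => ?_⟩
  · refine Primrec.nat_rec' (f := fun a : ℕ × ℕ => a.2) (g := fun _ => 0)
      (h := fun (a : ℕ × ℕ) (q : ℕ × ℕ) => bif b a.1 q.1 then q.2 else q.2 + 1)
      Primrec.snd (Primrec.const 0) ?_
    refine Primrec.cond (hb.comp (Primrec.fst.comp Primrec.fst) (Primrec.fst.comp Primrec.snd))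
      (Primrec.snd.comp Primrec.snd) (Primrec.succ.comp (Primrec.snd.comp Primrec.snd))
  · by_cases hp : p m
    · refine Or.inl ⟨hp, fun N => ?_⟩
      induction N with
      | zero => rfl
      | succ N ih =>
        have : b m N = false := by
          by_contra hN
          exact (hbex m).1 ⟨N, by simpa using hN⟩ hp
        rw [hsucc, this, ih]
        rfl
    · have hex := (hbex m).2 hp
      refine Or.inr ⟨hp, Nat.find hex, fun N => ?_⟩
      induction N with
      | zero => simp [d]
      | succ N ih =>
        rw [hsucc, ih]
        by_cases hN : Nat.find hex ≤ N
        · rw [hbmono m _ N hN (Nat.find_spec hex)]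
          simp
          omega
        · have : b m N = false := by simpa using Nat.find_min hex (not_le.1 hN)
          rw [this]
          simp
          omega

/-! ### Approximation of arctangents -/

/-- `N ^ 2` times a partial sum of the series of `arctan (1 / t)`, with all terms rounded. -/
def arctanSum (t N : ℕ) : ℕ :=
  ∑ j ∈ Finset.range N,
    (N ^ 2 / ((4 * j + 1) * t ^ (4 * j + 1)) - N ^ 2 / ((4 * j + 3) * t ^ (4 * j + 3)))

theorem primrec_arctanSum : Primrec₂ arctanSum := by
  have hterm : Primrec₂ fun (a : ℕ × ℕ) (j : ℕ) =>
      a.2 ^ 2 / ((4 * j + 1) * a.1 ^ (4 * j + 1)) - a.2 ^ 2 / ((4 * j + 3) * a.1 ^ (4 * j + 3)) := by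
    have hN : Primrec₂ fun (a : ℕ × ℕ) (_ : ℕ) => a.2 ^ 2 :=
      primrec_pow.comp (Primrec.snd.comp Primrec.fst) (Primrec.const 2)
    have hlin : ∀ q : ℕ, Primrec₂ fun (_ : ℕ × ℕ) (j : ℕ) => 4 * j + q := fun q =>
      Primrec.nat_add.comp (Primrec.nat_mul.comp (Primrec.const 4) Primrec.snd) (Primrec.const q)
    have hden : ∀ q : ℕ, Primrec₂ fun (a : ℕ × ℕ) (j : ℕ) => (4 * j + q) * a.1 ^ (4 * j + q) :=
      fun q => Primrec.nat_mul.comp (hlin q)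
        (primrec_pow.comp (Primrec.fst.comp Primrec.fst) (hlin q))
    exact Primrec.nat_sub.comp (Primrec.nat_div.comp hN (hden 1)) (Primrec.nat_div.comp hN (hden 3))
  have := Primrec.nat_rec' (f := fun a : ℕ × ℕ => a.2) (g := fun _ => 0)
    (h := fun (a : ℕ × ℕ) (q : ℕ × ℕ) => q.2 + (a.2 ^ 2 / ((4 * q.1 + 1) * a.1 ^ (4 * q.1 + 1)) -
      a.2 ^ 2 / ((4 * q.1 + 3) * a.1 ^ (4 * q.1 + 3))))
    Primrec.snd (Primrec.const 0) (Primrec.nat_add.comp (Primrec.snd.comp Primrec.snd)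
      (hterm.comp Primrec.fst (Primrec.fst.comp Primrec.snd)))
  refine this.of_eq fun a => ?_
  have key : ∀ M, (Nat.rec 0 (fun n IH => IH + (a.2 ^ 2 / ((4 * n + 1) * a.1 ^ (4 * n + 1)) -
      a.2 ^ 2 / ((4 * n + 3) * a.1 ^ (4 * n + 3)))) M : ℕ) = ∑ j ∈ Finset.range M,
      (a.2 ^ 2 / ((4 * j + 1) * a.1 ^ (4 * j + 1)) -
        a.2 ^ 2 / ((4 * j + 3) * a.1 ^ (4 * j + 3))) := by
    intro M
    induction M with
    | zero => rfl
    | succ M ih => rw [Finset.sum_range_succ, ← ih]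
  exact key a.2

/-- `t = 1` lies on the circle of convergence and is Leibniz's series; for larger `t` the power
series applies. -/
theorem tendsto_arctan_series {t : ℕ} (ht : 1 ≤ t) :
    Tendsto (fun n => ∑ i ∈ Finset.range n, (-1 : ℝ) ^ i * (1 / ((2 * i + 1) * t ^ (2 * i + 1))))
      atTop (𝓝 (Real.arctan (1 / t))) := by
  rcases ht.eq_or_lt with rfl | ht
  · have := Real.tendsto_sum_pi_div_four
    simpa [div_eq_mul_inv, Real.arctan_one] using this
  · have ht0 : (1 : ℝ) < t := by exact_mod_cast ht
    have hx : ‖1 / (t : ℝ)‖ < 1 := by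
      rw [Real.norm_of_nonneg (by positivity), div_lt_one (by positivity)]
      exact ht0
    refine (Real.hasSum_arctan hx).tendsto_sum_nat.congr fun n => Finset.sum_congr rfl fun i _ => ?_
    have e : (1 / (t : ℝ)) ^ (2 * i + 1) = 1 / (t : ℝ) ^ (2 * i + 1) := by rw [div_pow, one_pow]
    rw [e]
    push_cast
    field_simp

theorem sub_one_lt_nat_div {M D : ℕ} (hD : 0 < D) :
    ((M / D : ℕ) : ℝ) ≤ M / D ∧ (M : ℝ) / D - 1 < ((M / D : ℕ) : ℝ) := by
  refine ⟨Nat.cast_div_le, ?_⟩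
  have hD' : (0 : ℝ) < D := by exact_mod_cast hD
  have h : (M : ℝ) < ((M / D : ℕ) : ℝ) * D + D := by
    exact_mod_cast Nat.lt_div_mul_add (a := M) hD
  rw [sub_lt_iff_lt_add, div_lt_iff₀ hD']
  linarith

/-- Truncation and rounding cost `1 / N` each: the alternating series errs by at most its next term,
and `N` summands, each off by at most `1`, are divided by `N ^ 2`. -/
theorem abs_arctanSum_sub_le {t N : ℕ} (ht : 1 ≤ t) (hN : 1 ≤ N) :
    |(arctanSum t N : ℝ) / N ^ 2 - Real.arctan (1 / t)| ≤ 2 / N := by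
  set f : ℕ → ℝ := fun i => 1 / ((2 * i + 1) * t ^ (2 * i + 1)) with hf
  have ht1 : (1 : ℝ) ≤ t := by exact_mod_cast ht
  have hN0 : (0 : ℝ) < N := by exact_mod_cast hN
  have hanti : Antitone f := by
    refine antitone_nat_of_succ_le fun i => ?_
    simp only [hf]
    refine one_div_le_one_div_of_le (by positivity) ?_
    push_cast
    exact mul_le_mul (by linarith) (pow_le_pow_right₀ ht1 (by omega)) (by positivity) (by positivity)
  have hlo := hanti.alternating_series_le_tendsto (tendsto_arctan_series ht) N
  have hhi := hanti.tendsto_le_alternating_series (tendsto_arctan_series ht) N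
  rw [Finset.sum_range_succ] at hhi
  have hpair : ∀ M, ∑ i ∈ Finset.range (2 * M), (-1 : ℝ) ^ i * f i =
      ∑ j ∈ Finset.range M, (f (2 * j) - f (2 * j + 1)) := by
    intro M
    induction M with
    | zero => simp
    | succ M ih =>
      rw [show 2 * (M + 1) = 2 * M + 1 + 1 by ring, Finset.sum_range_succ, Finset.sum_range_succ, ih,
        Finset.sum_range_succ]
      simp [pow_succ, pow_mul]
      ring
  have hlast : (-1 : ℝ) ^ (2 * N) * f (2 * N) ≤ 1 / N := by
    rw [pow_mul, neg_one_sq, one_pow, one_mul]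
    refine one_div_le_one_div_of_le hN0 ?_
    have : (1 : ℝ) ≤ t ^ (2 * (2 * N) + 1) := one_le_pow₀ ht1
    push_cast
    nlinarith
  rw [hpair] at hlo hhi
  set S := ∑ j ∈ Finset.range N, (f (2 * j) - f (2 * j + 1)) with hS
  have hterm : ∀ j, |((N ^ 2 / ((4 * j + 1) * t ^ (4 * j + 1)) -
      N ^ 2 / ((4 * j + 3) * t ^ (4 * j + 3)) : ℕ) : ℝ) -
      N ^ 2 * (f (2 * j) - f (2 * j + 1))| ≤ 1 := by
    intro j
    have hD1 : 0 < (4 * j + 1) * t ^ (4 * j + 1) := by positivity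
    have hD3 : 0 < (4 * j + 3) * t ^ (4 * j + 3) := by positivity
    have hle : (4 * j + 1) * t ^ (4 * j + 1) ≤ (4 * j + 3) * t ^ (4 * j + 3) :=
      Nat.mul_le_mul (by omega) (Nat.pow_le_pow_right ht (by omega))
    -- The terms decrease, so the subtraction in `ℕ` does not truncate.
    rw [Nat.cast_sub (Nat.div_le_div_left hle hD1)]
    obtain ⟨a1, a2⟩ := sub_one_lt_nat_div (M := N ^ 2) hD1
    obtain ⟨b1, b2⟩ := sub_one_lt_nat_div (M := N ^ 2) hD3
    have e1 : (N : ℝ) ^ 2 * f (2 * j) = ((N ^ 2 : ℕ) : ℝ) / (((4 * j + 1) * t ^ (4 * j + 1) : ℕ) : ℝ) := by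
      simp only [hf]
      rw [show 2 * (2 * j) + 1 = 4 * j + 1 by ring]
      push_cast
      rw [mul_one_div]
      ring_nf
    have e3 : (N : ℝ) ^ 2 * f (2 * j + 1) =
        ((N ^ 2 : ℕ) : ℝ) / (((4 * j + 3) * t ^ (4 * j + 3) : ℕ) : ℝ) := by
      simp only [hf]
      rw [show 2 * (2 * j + 1) + 1 = 4 * j + 3 by ring]
      push_cast
      rw [mul_one_div]
      ring_nf
    rw [mul_sub, e1, e3, abs_le]
    constructor <;> linarith
  have hsum : |(arctanSum t N : ℝ) - N ^ 2 * S| ≤ N := by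
    rw [arctanSum, Nat.cast_sum, hS, Finset.mul_sum, ← Finset.sum_sub_distrib]
    refine (Finset.abs_sum_le_sum_abs _ _).trans ?_
    refine (Finset.sum_le_sum fun j _ => hterm j).trans ?_
    simp
  have hdiv : |(arctanSum t N : ℝ) / N ^ 2 - S| ≤ 1 / N := by
    have e : (arctanSum t N : ℝ) / N ^ 2 - S = (arctanSum t N - N ^ 2 * S) / N ^ 2 := by field_simp
    rw [e, abs_div, abs_of_pos (by positivity : (0 : ℝ) < N ^ 2), div_le_div_iff₀ (by positivity) hN0]
    nlinarith
  rw [abs_le] at hdiv ⊢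
  have h2 : (2 : ℝ) / N = 1 / N + 1 / N := by ring
  constructor <;> linarith [hdiv.1, hdiv.2]

theorem abs_arctan_sub_le (x y : ℝ) : |Real.arctan x - Real.arctan y| ≤ |x - y| := by
  have h : LipschitzWith 1 Real.arctan := by
    refine lipschitzWith_of_nnnorm_deriv_le Real.differentiable_arctan fun x => ?_
    rw [← NNReal.coe_le_coe, coe_nnnorm, Real.deriv_arctan, NNReal.coe_one,
      Real.norm_of_nonneg (by positivity)]
    rw [div_le_one (by positivity)]
    nlinarith [sq_nonneg x]
  simpa [Real.dist_eq] using h.dist_le_mul x y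

theorem arctan_le_of_nonneg {x : ℝ} (hx : 0 ≤ x) : Real.arctan x ≤ x := by
  have h := (le_abs_self _).trans (abs_arctan_sub_le x 0)
  rwa [Real.arctan_zero, sub_zero, sub_zero, abs_of_nonneg hx] at h

end PentagonTiling

end

section

open Filter Topology
open scoped Real

namespace PentagonTiling

/-! ### The reduction -/

/-- The reason for taking `φ = 2 arctan u`: `sin φ` and `cos (2φ)`, hence the length of the base,
are rational functions of `u`. -/
theorem houseLength_two_arctan (u : ℝ) : houseLength (2 * Real.arctan u) 0 =
    2 - 4 * (2 * u / (1 + u ^ 2)) ^ 2 - 2 * (2 * u / (1 + u ^ 2)) := by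
  have h0 : (0 : ℝ) < 1 + u ^ 2 := by positivity
  have hs : Real.sin (2 * Real.arctan u) = 2 * u / (1 + u ^ 2) := by
    rw [Real.sin_two_mul, Real.sin_arctan, Real.cos_arctan]
    have h := Real.sq_sqrt h0.le
    have hne : √(1 + u ^ 2) ≠ 0 := (Real.sqrt_pos.2 h0).ne'
    rw [eq_div_iff h0.ne']
    field_simp
    rw [h]
  have hc : Real.cos (2 * (2 * Real.arctan u)) = 1 - 2 * (2 * u / (1 + u ^ 2)) ^ 2 := by
    rw [← hs, Real.cos_two_mul, ← Real.sin_sq_add_cos_sq (2 * Real.arctan u)]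
    linarith [Real.sin_sq_add_cos_sq (2 * Real.arctan u)]
  simp only [houseLength, Matrix.cons_val_zero, hc, hs]
  ring

theorem abs_houseLength_sub_le {u u' : ℝ} (h0 : 0 ≤ u) (h1 : u ≤ 1 / 10) (h0' : 0 ≤ u')
    (h1' : u' ≤ 1 / 10) :
    |houseLength (2 * Real.arctan u) 0 - houseLength (2 * Real.arctan u') 0| ≤ 20 * |u - u'| := by
  rw [houseLength_two_arctan, houseLength_two_arctan]
  have hx : ∀ u : ℝ, 0 ≤ u → u ≤ 1 / 10 → 0 ≤ 2 * u / (1 + u ^ 2) ∧ 2 * u / (1 + u ^ 2) ≤ 1 / 5 := by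
    intro u h0 h1
    refine ⟨by positivity, ?_⟩
    rw [div_le_iff₀ (by positivity)]
    nlinarith [sq_nonneg u]
  have hd : |2 * u / (1 + u ^ 2) - 2 * u' / (1 + u' ^ 2)| ≤ 2 * |u - u'| := by
    have e : 2 * u / (1 + u ^ 2) - 2 * u' / (1 + u' ^ 2) =
        2 * (u - u') * ((1 - u * u') / ((1 + u ^ 2) * (1 + u' ^ 2))) := by
      field_simp
      ring
    have hq0 : 0 ≤ (1 - u * u') / ((1 + u ^ 2) * (1 + u' ^ 2)) :=
      div_nonneg (by nlinarith) (by positivity)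
    have hq1 : (1 - u * u') / ((1 + u ^ 2) * (1 + u' ^ 2)) ≤ 1 := by
      rw [div_le_one (by positivity)]
      nlinarith [mul_nonneg h0 h0', sq_nonneg u, sq_nonneg u', sq_nonneg (u * u')]
    rw [e, abs_mul, abs_mul, abs_two, abs_of_nonneg hq0]
    exact mul_le_of_le_one_right (by positivity) hq1
  obtain ⟨a0, a1⟩ := hx u h0 h1
  obtain ⟨b0, b1⟩ := hx u' h0' h1'
  set x := 2 * u / (1 + u ^ 2)
  set y := 2 * u' / (1 + u' ^ 2)
  have e : 2 - 4 * x ^ 2 - 2 * x - (2 - 4 * y ^ 2 - 2 * y) = -((4 * (x + y) + 2) * (x - y)) := by ring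
  rw [e, abs_neg, abs_mul, abs_of_nonneg (by positivity)]
  nlinarith [abs_nonneg (x - y)]

theorem houseLength_arctan_one_div {t : ℕ} (ht : 10 ≤ t) :
    houseLength (2 * Real.arctan (1 / t)) 0 =
      ((2 * (t ^ 2 + 1) ^ 2 - (4 * t * (t ^ 2 + 1) + 16 * t ^ 2) : ℕ) : ℝ) /
        (((t ^ 2 + 1) ^ 2 : ℕ) : ℝ) := by
  have hle : 4 * t * (t ^ 2 + 1) + 16 * t ^ 2 ≤ 2 * (t ^ 2 + 1) ^ 2 := by nlinarith
  have ht0 : (0 : ℝ) < t := by exact_mod_cast (by omega : 0 < t)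
  rw [houseLength_two_arctan, Nat.cast_sub hle]
  have e : 2 * (1 / (t : ℝ)) / (1 + (1 / (t : ℝ)) ^ 2) = 2 * t / (t ^ 2 + 1) := by
    field_simp
  rw [e]
  push_cast
  field_simp
  ring

/-- For every co-RE set there is a computable sequence of pentagons, each a rectangle with
additional vertex on one side, bent there if and only if its index is not in the set. -/
theorem exists_house_reduction {p : ℕ → Prop} (h : REPred fun n => ¬ p n) :
    ∃ f : ℕ → PolygonCode 5, Computable f ∧ ∀ m, ∃ φ : ℝ, 0 ≤ φ ∧ φ ≤ 1 / 5 ∧ (p m ↔ φ = 0) ∧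
      (f m).Computes (houseLength φ) (houseAngle φ) := by
  obtain ⟨d, hd, hdp⟩ := exists_halting_delay h
  -- The offset `10` gives `u ≤ 1/10`, whence `φ = 2 arctan u ≤ 1/5`.
  have hu : ∀ m, ∃ u : ℝ, 0 ≤ u ∧ u ≤ 1 / 10 ∧ (p m ↔ u = 0) ∧
      ∀ N : ℕ, 1 ≤ N → |1 / ((d m N + 10 : ℕ) : ℝ) - u| ≤ 1 / N := by
    intro m
    rcases hdp m with ⟨hp, hN⟩ | ⟨hp, k, hk⟩
    · refine ⟨0, le_rfl, by norm_num, by simp [hp], fun N h1 => ?_⟩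
      have : (0 : ℝ) < N := by exact_mod_cast h1
      rw [hN, sub_zero, abs_of_nonneg (by positivity)]
      exact one_div_le_one_div_of_le this (by push_cast; linarith)
    · refine ⟨1 / ((k + 10 : ℕ) : ℝ), by positivity, ?_, ?_, fun N h1 => ?_⟩
      · exact one_div_le_one_div_of_le (by norm_num) (by push_cast; linarith [k.cast_nonneg (α := ℝ)])
      · exact iff_of_false hp (by positivity)
      · have h1' : (0 : ℝ) < N := by exact_mod_cast h1
        rw [hk]
        rcases le_total N k with h | h
        · have hNk : (N : ℝ) ≤ k := by exact_mod_cast h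
          rw [min_eq_left h, abs_of_nonneg]
          · have : 1 / ((N + 10 : ℕ) : ℝ) ≤ 1 / N :=
              one_div_le_one_div_of_le h1' (by push_cast; linarith)
            have : 0 ≤ 1 / ((k + 10 : ℕ) : ℝ) := by positivity
            linarith
          · refine sub_nonneg.2 (one_div_le_one_div_of_le (by positivity) ?_)
            push_cast
            linarith
        · rw [min_eq_right h, sub_self, abs_zero]
          positivity
  choose u hu0 hu1 hup hud using hu
  -- the precision and the parameter
  let P : ℕ → ℕ := fun n => 64 * n
  let t : ℕ → ℕ → ℕ := fun m n => d m (P n) + 10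
  have hP : Primrec P := Primrec.nat_mul.comp (Primrec.const 64) Primrec.id
  have hP2 : Primrec₂ fun _ n : ℕ => P n := hP.comp₂ Primrec₂.right
  have ht : Primrec₂ t := Primrec.nat_add.comp₂ (hd.comp₂ Primrec₂.left hP2) (Primrec₂.const 10)
  have hPn : ∀ n, 1 ≤ n → 1 ≤ P n := fun n hn => by simp only [P]; omega
  have hc : ∀ k : ℕ, Primrec₂ fun _ _ : ℕ => k := fun k => Primrec₂.const k
  have hPr : ∀ n, 1 ≤ n → 1 / (P n : ℝ) = 1 / (64 * n) := fun n hn => by simp [P]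
  -- In units of `1 / P n` the errors are at most `20` for the base, `2·2 + 2·3 = 10` for the angles
  -- `π / 2 + φ` and `4·2 + 8·3 = 32` for the bent one.
  have hprec : ∀ n, 1 ≤ n → 32 * (1 / (P n : ℝ)) = 1 / (2 * n) := fun n hn => by
    have : (0 : ℝ) < n := by exact_mod_cast hn
    rw [hPr n hn]; field_simp; norm_num
  have hutr : ∀ m n, 1 ≤ n → |1 / (t m n : ℝ) - u m| ≤ 1 / P n := fun m n hn =>
    hud m (P n) (hPn n hn)
  have hA1 : ∀ n, 1 ≤ n → |(arctanSum 1 (P n) : ℝ) / (P n : ℝ) ^ 2 - π / 4| ≤ 2 * (1 / (P n : ℝ)) := by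
    intro n hn
    have := abs_arctanSum_sub_le le_rfl (hPn n hn)
    rw [Nat.cast_one, div_one, Real.arctan_one] at this
    rwa [mul_one_div]
  have hAt : ∀ m n, 1 ≤ n →
      |(arctanSum (t m n) (P n) : ℝ) / (P n : ℝ) ^ 2 - Real.arctan (u m)| ≤ 3 * (1 / (P n : ℝ)) := by
    intro m n hn
    have h1 := abs_arctanSum_sub_le (t := t m n) (by simp only [t]; omega) (hPn n hn)
    have h2 := (abs_arctan_sub_le (1 / (t m n : ℝ)) (u m)).trans (hutr m n hn)
    have h3 := abs_sub_le ((arctanSum (t m n) (P n) : ℝ) / (P n : ℝ) ^ 2)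
      (Real.arctan (1 / (t m n : ℝ))) (Real.arctan (u m))
    have e : (2 : ℝ) / P n = 2 * (1 / P n) := by ring
    linarith
  have hasP : Primrec₂ fun _ n : ℕ => arctanSum 1 (P n) := primrec_arctanSum.comp₂ (hc 1) hP2
  have hasT : Primrec₂ fun m n : ℕ => arctanSum (t m n) (P n) := primrec_arctanSum.comp₂ ht hP2
  have hPsq : Primrec₂ fun _ n : ℕ => P n ^ 2 := primrec_pow.comp₂ hP2 (hc 2)
  have hPpos : ∀ n, 1 ≤ n → 0 < P n ^ 2 := fun n hn => by have := hPn n hn; positivity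
  -- the programs
  obtain ⟨f₁, hf₁, hf₁'⟩ := exists_code_of_approx (hc 1) (hc 1) (a := fun _ => 1)
    (fun m n hn => ⟨one_pos, by simp⟩)
  obtain ⟨fb, hfb, hfb'⟩ := exists_code_of_approx
    (A := fun m n => 2 * (t m n ^ 2 + 1) ^ 2 - (4 * t m n * (t m n ^ 2 + 1) + 16 * t m n ^ 2))
    (B := fun m n => (t m n ^ 2 + 1) ^ 2) (a := fun m => houseLength (2 * Real.arctan (u m)) 0)
    (by
      have hq : Primrec₂ fun m n => t m n ^ 2 := primrec_pow.comp₂ ht (hc 2)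
      have hq1 : Primrec₂ fun m n => t m n ^ 2 + 1 := Primrec.nat_add.comp₂ hq (hc 1)
      exact Primrec.nat_sub.comp₂ (Primrec.nat_mul.comp₂ (hc 2) (primrec_pow.comp₂ hq1 (hc 2)))
        (Primrec.nat_add.comp₂ (Primrec.nat_mul.comp₂ (Primrec.nat_mul.comp₂ (hc 4) ht) hq1)
          (Primrec.nat_mul.comp₂ (hc 16) hq)))
    (primrec_pow.comp₂ (Primrec.nat_add.comp₂ (primrec_pow.comp₂ ht (hc 2)) (hc 1)) (hc 2))
    (fun m n hn => by
      refine ⟨by positivity, ?_⟩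
      have h10 : 10 ≤ t m n := by simp only [t]; omega
      have h10' : (10 : ℝ) ≤ t m n := by exact_mod_cast h10
      rw [← houseLength_arctan_one_div h10]
      refine (abs_houseLength_sub_le (by positivity)
        (one_div_le_one_div_of_le (by norm_num) h10') (hu0 m) (hu1 m)).trans ?_
      rw [← hprec n hn]
      have := hutr m n hn
      have h0 : 0 ≤ 1 / (P n : ℝ) := by positivity
      linarith)
  obtain ⟨fα, hfα, hfα'⟩ := exists_code_of_approx
    (A := fun m n => 2 * arctanSum 1 (P n) + 2 * arctanSum (t m n) (P n))
    (B := fun _ n => P n ^ 2) (a := fun m => π / 2 + 2 * Real.arctan (u m))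
    (Primrec.nat_add.comp₂ (Primrec.nat_mul.comp₂ (hc 2) hasP) (Primrec.nat_mul.comp₂ (hc 2) hasT))
    hPsq (fun m n hn => by
      refine ⟨hPpos n hn, ?_⟩
      have h1 := abs_le.1 (hA1 n hn)
      have h2 := abs_le.1 (hAt m n hn)
      have h0 : 0 ≤ 1 / (P n : ℝ) := by positivity
      rw [← hprec n hn]
      push_cast
      rw [add_div, mul_div_assoc, mul_div_assoc, abs_le]
      constructor <;> linarith [h1.1, h1.2, h2.1, h2.2])
  obtain ⟨fβ, hfβ, hfβ'⟩ := exists_code_of_approx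
    (A := fun m n => 4 * arctanSum 1 (P n) - 8 * arctanSum (t m n) (P n))
    (B := fun _ n => P n ^ 2) (a := fun m => π - 4 * (2 * Real.arctan (u m)))
    (Primrec.nat_sub.comp₂ (Primrec.nat_mul.comp₂ (hc 4) hasP) (Primrec.nat_mul.comp₂ (hc 8) hasT))
    hPsq (fun m n hn => by
      refine ⟨hPpos n hn, ?_⟩
      have h1 := abs_le.1 (hA1 n hn)
      have h2 := abs_le.1 (hAt m n hn)
      have h0 : 0 ≤ 1 / (P n : ℝ) := by positivity
      have hsq : (0 : ℝ) < (P n : ℝ) ^ 2 := by exact_mod_cast hPpos n hn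
      have harc := (arctan_le_of_nonneg (hu0 m)).trans (hu1 m)
      rw [← hprec n hn]
      -- If the subtraction truncates, the untruncated value is at most `0` and the true angle is
      -- positive, so `0` is at least as good an approximation.
      rcases le_total (8 * arctanSum (t m n) (P n)) (4 * arctanSum 1 (P n)) with hle | hle
      · push_cast [Nat.cast_sub hle]
        rw [sub_div, mul_div_assoc, mul_div_assoc, abs_le]
        constructor <;> linarith [h1.1, h1.2, h2.1, h2.2]
      · have hle' : (4 * arctanSum 1 (P n) : ℝ) ≤ 8 * arctanSum (t m n) (P n) := by exact_mod_cast hle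
        have hle2 := div_le_div_of_nonneg_right hle' hsq.le
        rw [mul_div_assoc, mul_div_assoc] at hle2
        rw [Nat.sub_eq_zero_of_le hle, Nat.cast_zero, zero_div, abs_le]
        constructor <;> linarith [h1.1, h1.2, h2.1, h2.2, Real.pi_gt_three])
  refine ⟨fun m => (![fb m, f₁ m, f₁ m, f₁ m, f₁ m], ![fα m, fα m, fα m, fβ m, fα m]), ?_,
    fun m => ⟨2 * Real.arctan (u m), ?_, ?_, ?_, ?_, ?_⟩⟩
  · have hfin : ∀ g : ℕ → Fin 5 → Nat.Partrec.Code, (∀ i, Primrec fun m => g m i) → Primrec g :=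
      fun g hg => Primrec.fin_curry.2 (Primrec.fin_curry₁.2 hg).swap
    refine (Primrec.pair (hfin _ fun i => ?_) (hfin _ fun i => ?_)).to_comp
    · fin_cases i
      exacts [hfb, hf₁, hf₁, hf₁, hf₁]
    · fin_cases i
      exacts [hfα, hfα, hfα, hfβ, hfα]
  · exact mul_nonneg two_pos.le (Real.arctan_nonneg.2 (hu0 m))
  · linarith [(arctan_le_of_nonneg (hu0 m)).trans (hu1 m)]
  · rw [hup, mul_eq_zero, or_iff_right two_ne_zero, Real.arctan_eq_zero_iff]
  · intro i
    fin_cases i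
    exacts [hfb' m, hf₁' m, hf₁' m, hf₁' m, hf₁' m]
  · intro i
    fin_cases i
    exacts [hfα' m, hfα' m, hfα' m, hfβ' m, hfα' m]

/-- The rectangle tiles by motions in `G`, and bent pentagons fail for any `G`, so one reduction
handles both versions. -/
theorem coREHard_tilingProblem {G : Set (ℂ ≃ᵢ ℂ)} (hG : properMotions ⊆ G) :
    (tilingProblem 5 G).CoREHard := by
  intro p hp
  obtain ⟨f, hf, hfp⟩ := exists_house_reduction hp
  refine ⟨f, hf, fun m => ?_⟩
  obtain ⟨φ, h0, h1, hpφ, hcomp⟩ := hfp m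
  refine ⟨⟨_, _, hcomp, isSimpleClosedPolygon_house h0 h1⟩, ?_, ?_⟩
  · intro hpm
    obtain rfl := hpφ.1 hpm
    refine ⟨_, _, hcomp, isSimpleClosedPolygon_house h0 h1, ?_⟩
    rw [region_house_zero]
    exact tilesPlane_rectangle.mono hG
  · rintro ⟨L, θ, hc, -, htile⟩
    obtain rfl : L = houseLength φ := funext fun i => computesReal_unique (hc.1 i) (hcomp.1 i)
    obtain rfl : θ = houseAngle φ := funext fun i => computesReal_unique (hc.2 i) (hcomp.2 i)
    by_contra hpm
    exact not_tilesPlane_house (lt_of_le_of_ne h0 fun h => hpm (hpφ.2 h.symm)) h1 G htile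

/-! ### From hardness to undecidability -/

theorem PromiseProblem.CoREHard.not_decidable {α : Type} [Primcodable α] {Q : PromiseProblem α}
    (h : Q.CoREHard) : ¬ Q.Decidable := by
  classical
  rintro ⟨g, hg, hQ⟩
  -- Non-halting on input `0` is co-RE. Reduced instances satisfy the promise, so a decision
  -- procedure composed with the reduction would solve the halting problem.
  let p : ℕ → Prop := fun n => ¬ ((Denumerable.ofNat Nat.Partrec.Code n).eval 0).Dom
  have hp : REPred fun n => ¬ p n := by
    have : Partrec fun n => (Denumerable.ofNat Nat.Partrec.Code n).eval 0 :=
      Nat.Partrec.Code.eval_part.comp (Computable.ofNat _) (Computable.const 0)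
    exact this.dom_re.of_eq fun n => by simp [p]
  obtain ⟨f, hf, hfp⟩ := h p hp
  have hdec : Computable fun n => decide (p n) := by
    refine (hg.comp hf).of_eq fun n => Part.eq_some_iff.2 ?_
    by_cases hn : p n
    · simpa [hn] using (hQ _ (hfp n).1).1 ((hfp n).2.1 hn)
    · simpa [hn] using (hQ _ (hfp n).1).2 fun hy => hn ((hfp n).2.2 hy)
  refine ComputablePred.halting_problem 0 ?_
  have hnot : ComputablePred fun c : Nat.Partrec.Code => p (Encodable.encode c) :=
    ComputablePred.computable_iff.2 ⟨fun c => decide (p (Encodable.encode c)),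
      hdec.comp Computable.encode, by simp⟩
  exact hnot.not.of_eq fun c => by simp [p]

end PentagonTiling

end

theorem mainTheorem7 :
    ((PentagonTiling.tilingProblem 5 Set.univ).CoREHard ∧
      ¬ (PentagonTiling.tilingProblem 5 Set.univ).Decidable) ∧
    ((PentagonTiling.tilingProblem 5 PentagonTiling.properMotions).CoREHard ∧
      ¬ (PentagonTiling.tilingProblem 5 PentagonTiling.properMotions).Decidable) := by
  have h1 := PentagonTiling.coREHard_tilingProblem (Set.subset_univ PentagonTiling.properMotions)
  have h2 := PentagonTiling.coREHard_tilingProblem (Set.Subset.refl PentagonTiling.properMotions)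
  exact ⟨⟨h1, h1.not_decidable⟩, h2, h2.not_decidable⟩
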